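/- **Setting.** All vector spaces are over $\mathbb{Q}$. For a finite set $A$ let $\mathfrak{Lie}(A)$ be the multilinear part of the free Lie algebra on $A$ (the span of the iterated brackets in which each letter of $A$ occurs exactly once); this is the Lie operad, and $\mathfrak{Lie}(\emptyset)=0$. For finite sets $S,T$ put $$\mathsf{CatLie}(S,T)=\bigoplus_{f\colon S\twoheadrightarrow T}\ \bigotimes_{t\in T}\mathfrak{Lie}(f^{-1}(t)),$$ the sum being over surjections, with composition given by composition of surjections and operadic composition. $\mathsf{CatLie}$ is the resulting $\mathbb{Q}$-linear category with objects the $n\in\mathbb{N}$ (identified with $\{1,\dots,n\}$). Let $\mathbf{\Sigma}$ be the category of finite sets and bijections. A *left $\mathsf{CatLie}$, right $\mathbb{Q}\mathbf{\Sigma}$-bimodule* is a $\mathbb{Q}$-linear functor from $\mathsf{CatLie}$ to the category of functors $\mathbf{\Sigma}^{\mathrm{op}}\to\mathbb{Q}\text{-vector spaces}$; these form an abelian category. For instance $\mathsf{CatLie}$ itself is the bimodule $n\mapsto(S\mapsto\mathsf{CatLie}(S,n))$. Let $I$ be the right $\mathbb{Q}\mathbf{\Sigma}$-module which is $\mathbb{Q}$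 on one-element sets (with trivial action) and $0$ on all others, and let $\odot$ be the convolution product, so that $$(\mathsf{CatLie}\odot I)(S,n)=\bigoplus_{S=S_1\amalg S_2}\mathsf{CatLie}(S_1,n)\otimes I(S_2),$$ with $\mathsf{CatLie}$ acting through the first factor. Write $\delta$ for restriction of bimodules along the functor $-\boxplus 1\colon\mathsf{CatLie}\to\mathsf{CatLie}$, $n\mapsto n+1$, so that $(\delta\,\mathsf{CatLie})(S,n)=\mathsf{CatLie}(S,n+1)$. Let $\mu(n)\in\mathsf{CatLie}(n+1,n)$ be $\sum_{i=1}^n\mu_i(n)$, where $\mu_i(n)$ lies in the summand of the surjection which is the identity on $\{1,\dots,n\}$ and sends $n+1$ to $i$, and is given by the bracket $[x_i,x_{n+1}]$ in the $i$-th factor and by $x_j$ in the $j$-th factor, $j\neq i$ (so $\mu(0)=0$). Left multiplication by the $\mu(n)$ is a morphism $\tilde\mu\colon\delta\,\mathsf{CatLie}\to\mathsf{CatLie}$. Let $\delta^{(1)}\mathsf{CatLie}\subset\delta\,\mathsf{CatLie}$ be the sum of the summands indexed by the surjections $f\colon S\twoheadrightarrow\{1,\dots,n+1\}$ with $|f^{-1}(n+1)|=1$.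 The map $\varphi\otimes 1\mapsto\varphi\boxplus 1$ (on the summand with $|S_2|=1$) is a morphism $\mathsf{CatLie}\odot I\to\delta\,\mathsf{CatLie}$. The two-term complex underlying $\mathbb{C}\mathfrak{Lie}$ is $$d\colon\ \mathsf{CatLie}\odot I\longrightarrow\delta\,\mathsf{CatLie}\xrightarrow{\ \tilde\mu\ }\mathsf{CatLie},$$ with $\mathsf{CatLie}\odot I$ in homological degree $1$ and $\mathsf{CatLie}$ in degree $0$. Let $\mathbf{H}_0=\operatorname{coker}d$ and $\mathbf{H}_1=\ker d$ be its homology bimodules. **Theorem.** The morphism $\mathsf{CatLie}\odot I\to\delta\,\mathsf{CatLie}$ is an isomorphism onto $\delta^{(1)}\mathsf{CatLie}$. In the abelian category of left $\mathsf{CatLie}$, right $\mathbb{Q}\mathbf{\Sigma}$-bimodules: 1. $\mathsf{CatLie}$ and $\mathsf{CatLie}\odot I$ are projective, and the complex provides the beginning of a projective resolution of $\mathbf{H}_0$: there is a projective resolution $\cdots\to R_2\to R_1\to R_0\to\mathbf{H}_0\to 0$ with $R_1\to R_0\to\mathbf{H}_0$ isomorphic to $\mathsf{CatLie}\odot I\xrightarrow{d}\mathsf{CatLie}\to\mathbf{H}_0$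 (as sequences over $\mathbf{H}_0$). 2. Hence the sequence $$0\to\mathbf{H}_1\to\mathsf{CatLie}\odot I\xrightarrow{\ d\ }\mathsf{CatLie}\to\mathbf{H}_0\to0,$$ in which the maps from $\mathbf{H}_1$ and to $\mathbf{H}_0$ are the canonical ones, is exact with projective middle terms, and so exhibits $\mathbf{H}_1$ as the second syzygy of $\mathbf{H}_0$. -/

import Mathlib

open CategoryTheory Limits
open scoped TensorProduct DirectSum

noncomputable section

namespace CatLieSyzygy

/-! ### The Lie operad -/

/-- `IsLieMonomial A x`: `x` is an iterated Lie bracket of the free generators in which each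
letter of `A` occurs exactly once and no other letter occurs. -/
inductive IsLieMonomial {S : Type} : Set S → FreeLieAlgebra ℚ S → Prop
  | of (s : S) : IsLieMonomial {s} (FreeLieAlgebra.of ℚ s)
  | bracket {A B : Set S} {x y : FreeLieAlgebra ℚ S} (hAB : Disjoint A B)
      (hx : IsLieMonomial A x) (hy : IsLieMonomial B y) : IsLieMonomial (A ∪ B) ⁅x, y⁆

/-- The value `𝔏𝔦𝔢(A)` of the Lie operad on a (finite) set `A`: the part of the free Lie algebra
which is multilinear in the letters of `A`. We allow `A` to be a subset of a bigger alphabet `S`;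
this does not change the vector space, as the free Lie algebra on `A` embeds in the one on `S`. -/
def lieOn {S : Type} (A : Set S) : Submodule ℚ (FreeLieAlgebra ℚ S) :=
  Submodule.span ℚ {x | IsLieMonomial A x}

theorem of_mem_lieOn {S : Type} {A : Set S} (s : S) (h : A = {s}) :
    FreeLieAlgebra.of ℚ s ∈ lieOn A := by
  subst h
  exact Submodule.subset_span (.of s)

theorem lie_mem_lieOn {S : Type} {A B : Set S} (hAB : Disjoint A B) {x y : FreeLieAlgebra ℚ S}
    (hx : x ∈ lieOn A) (hy : y ∈ lieOn B) : ⁅x, y⁆ ∈ lieOn (A ∪ B) := by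
  induction hx, hy using Submodule.span_induction₂ with
  | mem_mem x y hx hy => exact Submodule.subset_span (.bracket hAB hx hy)
  | zero_left y hy => simp
  | zero_right x hx => simp
  | add_left x y z _ _ _ h₁ h₂ => rw [add_lie]; exact add_mem h₁ h₂
  | add_right x y z _ _ _ h₁ h₂ => rw [lie_add]; exact add_mem h₁ h₂
  | smul_left r x y _ _ h => rw [smul_lie]; exact Submodule.smul_mem _ _ h
  | smul_right r x y _ _ h => rw [lie_smul]; exact Submodule.smul_mem _ _ h

/-- Operadic substitution preserves multilinear parts. -/
theorem subst_mem {S T : Type} (f : S → T) (a : T → FreeLieAlgebra ℚ S)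
    (ha : ∀ t, a t ∈ lieOn (f ⁻¹' {t})) {B : Set T} {b : FreeLieAlgebra ℚ T} (hb : b ∈ lieOn B) :
    FreeLieAlgebra.lift ℚ a b ∈ lieOn (f ⁻¹' B) := by
  induction hb using Submodule.span_induction with
  | mem x hx =>
    induction hx with
    | of s => simpa [FreeLieAlgebra.lift_of_apply] using ha s
    | bracket hAB _ _ h₁ h₂ =>
      rw [LieHom.map_lie, Set.preimage_union]
      exact lie_mem_lieOn (hAB.preimage f) h₁ h₂
  | zero => simp
  | add x y _ _ h₁ h₂ => rw [map_add]; exact add_mem h₁ h₂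
  | smul r x _ h => rw [map_smul]; exact Submodule.smul_mem _ _ h

theorem subst_mem_comp {S T U : Type} (f : S → T) (g : T → U) (a : T → FreeLieAlgebra ℚ S)
    (ha : ∀ t, a t ∈ lieOn (f ⁻¹' {t})) (u : U) {b : FreeLieAlgebra ℚ T}
    (hb : b ∈ lieOn (g ⁻¹' {u})) : FreeLieAlgebra.lift ℚ a b ∈ lieOn ((g ∘ f) ⁻¹' {u}) := by
  rw [Set.preimage_comp]
  exact subst_mem f a ha hb

theorem subst_congr {T : Type} {L : Type} [LieRing L] [LieAlgebra ℚ L] {a a' : T → L}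
    {B : Set T} (h : ∀ t ∈ B, a t = a' t) {b : FreeLieAlgebra ℚ T} (hb : b ∈ lieOn B) :
    FreeLieAlgebra.lift ℚ a b = FreeLieAlgebra.lift ℚ a' b := by
  induction hb using Submodule.span_induction with
  | mem x hx =>
    induction hx with
    | of s => simpa [FreeLieAlgebra.lift_of_apply] using h s rfl
    | bracket hAB _ _ h₁ h₂ =>
      rw [LieHom.map_lie, LieHom.map_lie, h₁ fun t ht => h t (.inl ht),
        h₂ fun t ht => h t (.inr ht)]
  | zero => simp
  | add x y _ _ h₁ h₂ => rw [map_add, map_add, h₁, h₂]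
  | smul r x _ h => rw [map_smul, map_smul, h]

theorem subst_update_of_notMem {T : Type} [DecidableEq T] {L : Type} [LieRing L] [LieAlgebra ℚ L]
    (a : T → L) (t : T) (z : L) {B : Set T} (ht : t ∉ B)
    {b : FreeLieAlgebra ℚ T} (hb : b ∈ lieOn B) :
    FreeLieAlgebra.lift ℚ (Function.update a t z) b = FreeLieAlgebra.lift ℚ a b := by
  refine subst_congr (fun s hs => ?_) hb
  have hst : s ≠ t := fun e => ht (e ▸ hs)
  exact Function.update_of_ne hst z a

theorem IsLieMonomial.mem {T : Type} {B : Set T} {b : FreeLieAlgebra ℚ T}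
    (h : IsLieMonomial B b) : b ∈ lieOn B := Submodule.subset_span h

theorem subst_update_add {T : Type} [DecidableEq T] {L : Type} [LieRing L] [LieAlgebra ℚ L]
    (a : T → L) (t : T) (x y : L) {B : Set T} (ht : t ∈ B)
    {b : FreeLieAlgebra ℚ T} (hb : b ∈ lieOn B) :
    FreeLieAlgebra.lift ℚ (Function.update a t (x + y)) b =
      FreeLieAlgebra.lift ℚ (Function.update a t x) b +
      FreeLieAlgebra.lift ℚ (Function.update a t y) b := by
  induction hb using Submodule.span_induction with
  | mem z hz =>
    induction hz with
    | of s =>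
      obtain rfl : t = s := ht
      rw [FreeLieAlgebra.lift_of_apply, FreeLieAlgebra.lift_of_apply,
        FreeLieAlgebra.lift_of_apply, Function.update_self, Function.update_self,
        Function.update_self]
    | @bracket A B p q hAB hp hq h₁ h₂ =>
      rw [LieHom.map_lie, LieHom.map_lie, LieHom.map_lie]
      rcases ht with ht | ht
      · have hn : t ∉ B := fun h => Set.disjoint_left.1 hAB ht h
        rw [h₁ ht, subst_update_of_notMem a t _ hn hq.mem, subst_update_of_notMem a t _ hn hq.mem,
          subst_update_of_notMem a t _ hn hq.mem, add_lie]
      · have hn : t ∉ A := fun h => Set.disjoint_left.1 hAB h ht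
        rw [h₂ ht, subst_update_of_notMem a t _ hn hp.mem, subst_update_of_notMem a t _ hn hp.mem,
          subst_update_of_notMem a t _ hn hp.mem, lie_add]
  | zero => rw [map_zero, map_zero, map_zero, add_zero]
  | add x y _ _ h₁ h₂ => rw [map_add, map_add, map_add, h₁, h₂]; abel
  | smul r x _ h => rw [map_smul, map_smul, map_smul, h, smul_add]

theorem subst_update_smul {T : Type} [DecidableEq T] {L : Type} [LieRing L] [LieAlgebra ℚ L]
    (a : T → L) (t : T) (r : ℚ) (x : L) {B : Set T} (ht : t ∈ B)
    {b : FreeLieAlgebra ℚ T} (hb : b ∈ lieOn B) :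
    FreeLieAlgebra.lift ℚ (Function.update a t (r • x)) b =
      r • FreeLieAlgebra.lift ℚ (Function.update a t x) b := by
  induction hb using Submodule.span_induction with
  | mem z hz =>
    induction hz with
    | of s =>
      obtain rfl : t = s := ht
      rw [FreeLieAlgebra.lift_of_apply, FreeLieAlgebra.lift_of_apply,
        Function.update_self, Function.update_self]
    | @bracket A B p q hAB hp hq h₁ h₂ =>
      rw [LieHom.map_lie, LieHom.map_lie]
      rcases ht with ht | ht
      · have hn : t ∉ B := fun h => Set.disjoint_left.1 hAB ht h
        rw [h₁ ht, subst_update_of_notMem a t _ hn hq.mem, subst_update_of_notMem a t _ hn hq.mem,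
          smul_lie]
      · have hn : t ∉ A := fun h => Set.disjoint_left.1 hAB h ht
        rw [h₂ ht, subst_update_of_notMem a t _ hn hp.mem, subst_update_of_notMem a t _ hn hp.mem,
          lie_smul]
  | zero => rw [map_zero, map_zero, smul_zero]
  | add x y _ _ h₁ h₂ => rw [map_add, map_add, h₁, h₂, smul_add]
  | smul r' x _ h => rw [map_smul, map_smul, h, smul_comm]

/-! ### The morphism spaces of the PROP -/

/-- The summand of `CatLie(S, T)` indexed by a map `f : S → T`, that is `⨂_{t ∈ T} 𝔏𝔦𝔢(f⁻¹(t))`. -/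
def Summand {S T : Type} (f : S → T) : Type :=
  ⨂[ℚ] t : T, lieOn (f ⁻¹' {t})

instance {S T : Type} (f : S → T) : AddCommGroup (Summand f) :=
  inferInstanceAs (AddCommGroup (⨂[ℚ] t : T, lieOn (f ⁻¹' {t})))

instance {S T : Type} (f : S → T) : Module ℚ (Summand f) :=
  inferInstanceAs (Module ℚ (⨂[ℚ] t : T, lieOn (f ⁻¹' {t})))

/-- The pure tensor `⨂_t a_t`. -/
def pureTensor {S T : Type} (f : S → T) :
    MultilinearMap ℚ (fun t : T => lieOn (f ⁻¹' {t})) (Summand f) :=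
  PiTensorProduct.tprod ℚ

/-- The universal property of the tensor product `⨂_{t ∈ T} 𝔏𝔦𝔢(f⁻¹(t))`. -/
def summandLift {S T : Type} {f : S → T} {M : Type} [AddCommMonoid M] [Module ℚ M]
    (F : MultilinearMap ℚ (fun t : T => lieOn (f ⁻¹' {t})) M) : Summand f →ₗ[ℚ] M :=
  PiTensorProduct.lift F

@[simp]
theorem summandLift_pureTensor {S T : Type} {f : S → T} {M : Type} [AddCommMonoid M] [Module ℚ M]
    (F : MultilinearMap ℚ (fun t : T => lieOn (f ⁻¹' {t})) M) (a : ∀ t, lieOn (f ⁻¹' {t})) :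
    summandLift F (pureTensor f a) = F a :=
  PiTensorProduct.lift.tprod a

theorem summand_ext {S T : Type} {f : S → T} {M : Type} [AddCommMonoid M] [Module ℚ M]
    {F G : Summand f →ₗ[ℚ] M} (h : ∀ a, F (pureTensor f a) = G (pureTensor f a)) : F = G :=
  PiTensorProduct.ext (MultilinearMap.ext h)

/-- The space of morphisms `CatLie(S, T) = ⨁_{f : S ↠ T} ⨂_{t ∈ T} 𝔏𝔦𝔢(f⁻¹(t))`, for finite sets
`S` and `T`. -/
def LieHoms (S T : Type) : Type :=
  ⨁ f : {f : S → T // Function.Surjective f}, Summand f.1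

instance (S T : Type) : AddCommGroup (LieHoms S T) :=
  inferInstanceAs (AddCommGroup (⨁ f : {f : S → T // Function.Surjective f}, Summand f.1))

instance (S T : Type) : Module ℚ (LieHoms S T) :=
  inferInstanceAs (Module ℚ (⨁ f : {f : S → T // Function.Surjective f}, Summand f.1))

open Classical in
/-- The inclusion of the summand indexed by `f`. -/
def summandι {S T : Type} (f : {f : S → T // Function.Surjective f}) :
    Summand f.1 →ₗ[ℚ] LieHoms S T :=
  DirectSum.lof ℚ _ (fun f : {f : S → T // Function.Surjective f} => Summand f.1) f

open Classical in
/-- The linear map out of `CatLie(S, T)` with given restriction to each summand. -/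
def summandDesc {S T : Type} {M : Type} [AddCommMonoid M] [Module ℚ M]
    (F : ∀ f : {f : S → T // Function.Surjective f}, Summand f.1 →ₗ[ℚ] M) :
    LieHoms S T →ₗ[ℚ] M :=
  DirectSum.toModule ℚ _ M F

@[simp]
theorem summandDesc_summandι {S T : Type} {M : Type} [AddCommMonoid M] [Module ℚ M]
    (F : ∀ f : {f : S → T // Function.Surjective f}, Summand f.1 →ₗ[ℚ] M)
    (f : {f : S → T // Function.Surjective f}) (x : Summand f.1) :
    summandDesc F (summandι f x) = F f x := by
  classical
  exact DirectSum.toModule_lof ..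

/-- The element of `CatLie(S, T)` given by a surjection `f` and a family `a t ∈ 𝔏𝔦𝔢(f⁻¹(t))`. -/
def elem {S T : Type} (f : S → T) (hf : Function.Surjective f) (a : T → FreeLieAlgebra ℚ S)
    (ha : ∀ t, a t ∈ lieOn (f ⁻¹' {t})) : LieHoms S T :=
  summandι ⟨f, hf⟩ (pureTensor f fun t => ⟨a t, ha t⟩)

theorem elem_congr {S T : Type} {f f' : S → T} (hff' : f = f') {a a' : T → FreeLieAlgebra ℚ S}
    (haa' : a = a') (hf : Function.Surjective f) (hf' : Function.Surjective f')
    (ha : ∀ t, a t ∈ lieOn (f ⁻¹' {t})) (ha' : ∀ t, a' t ∈ lieOn (f' ⁻¹' {t})) :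
    elem f hf a ha = elem f' hf' a' ha' := by
  subst hff' haa'
  rfl

theorem lieHoms_ext {S T : Type} {M : Type} [AddCommMonoid M] [Module ℚ M]
    {F G : LieHoms S T →ₗ[ℚ] M} (h : ∀ f hf a ha, F (elem f hf a ha) = G (elem f hf a ha)) :
    F = G := by
  classical
  refine DirectSum.linearMap_ext _ fun f => summand_ext fun a => ?_
  exact h f.1 f.2 (fun t => a t) (fun t => (a t).2)

/-- The operadic substitution `b_u(a) ∈ 𝔏𝔦𝔢((g ∘ f)⁻¹(u))` of a family `a t ∈ 𝔏𝔦𝔢(f⁻¹(t))` in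
`b_u ∈ 𝔏𝔦𝔢(g⁻¹(u))`. -/
def subst {S T U : Type} (f : S → T) (g : T → U) (a : ∀ t, lieOn (f ⁻¹' {t})) (u : U)
    (b : lieOn (g ⁻¹' {u})) : lieOn ((g ∘ f) ⁻¹' {u}) :=
  ⟨FreeLieAlgebra.lift ℚ (fun t => (a t : FreeLieAlgebra ℚ S)) (b : FreeLieAlgebra ℚ T),
    subst_mem_comp f g _ (fun t => (a t).2) u b.2⟩

theorem coe_update {S T : Type} [DecidableEq T] {f : S → T} (a : ∀ t, lieOn (f ⁻¹' {t})) (t : T)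
    (z : lieOn (f ⁻¹' {t})) :
    (fun t' => (Function.update a t z t' : FreeLieAlgebra ℚ S)) =
      Function.update (fun t' => (a t' : FreeLieAlgebra ℚ S)) t z := by
  ext t'
  rcases eq_or_ne t' t with rfl | h
  · rw [Function.update_self, Function.update_self]
  · rw [Function.update_of_ne h, Function.update_of_ne h]

theorem subst_update_left {S T U : Type} [DecidableEq T] [DecidableEq U] (f : S → T) (g : T → U)
    (b : ∀ u, lieOn (g ⁻¹' {u})) (a : ∀ t, lieOn (f ⁻¹' {t})) (t : T) (z : lieOn (f ⁻¹' {t})) :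
    (fun u => subst f g (Function.update a t z) u (b u)) =
      Function.update (fun u => subst f g a u (b u)) (g t)
        (subst f g (Function.update a t z) (g t) (b (g t))) := by
  funext u
  rcases eq_or_ne u (g t) with rfl | h
  · rw [Function.update_self]
  · rw [Function.update_of_ne h]
    refine Subtype.ext ?_
    have ht : t ∉ g ⁻¹' {u} := fun h' => h h'.symm
    simp only [subst, coe_update]
    exact subst_update_of_notMem _ t _ ht (b u).2

/-- Operadic substitution, as a multilinear map `(a t)_t ↦ ⨂_u b_u(a)`. -/
def substTensor {S T U : Type} (f : S → T) (g : T → U) (b : ∀ u, lieOn (g ⁻¹' {u})) :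
    MultilinearMap ℚ (fun t : T => lieOn (f ⁻¹' {t})) (Summand (g ∘ f)) where
  toFun a := pureTensor (g ∘ f) fun u => subst f g a u (b u)
  map_update_add' := by
    classical
    intro _ m t x y
    rw [subst_update_left, subst_update_left f g b m t x, subst_update_left f g b m t y,
      ← MultilinearMap.map_update_add]
    congr 2
    refine Subtype.ext ?_
    simp only [subst, Submodule.coe_add, coe_update]
    exact subst_update_add _ t _ _ (B := g ⁻¹' {g t}) rfl (b (g t)).2
  map_update_smul' := by
    classical
    intro _ m t r x
    rw [subst_update_left, subst_update_left f g b m t x, ← MultilinearMap.map_update_smul]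
    congr 2
    refine Subtype.ext ?_
    simp only [subst, Submodule.coe_smul, coe_update]
    exact subst_update_smul _ t _ _ (B := g ⁻¹' {g t}) rfl (b (g t)).2

theorem subst_update_right {S T U : Type} [DecidableEq U] (f : S → T) (g : T → U)
    (b : ∀ u, lieOn (g ⁻¹' {u})) (a : ∀ t, lieOn (f ⁻¹' {t})) (u : U) (z : lieOn (g ⁻¹' {u})) :
    (fun u' => subst f g a u' (Function.update b u z u')) =
      Function.update (fun u' => subst f g a u' (b u')) u (subst f g a u z) := by
  funext u'
  rcases eq_or_ne u' u with rfl | h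
  · rw [Function.update_self, Function.update_self]
  · rw [Function.update_of_ne h, Function.update_of_ne h]

/-- Operadic composition, as a bilinear map between summands. -/
def compTensor {S T U : Type} (f : S → T) (g : T → U) :
    Summand g →ₗ[ℚ] Summand f →ₗ[ℚ] Summand (g ∘ f) :=
  summandLift
    { toFun := fun b => summandLift (substTensor f g b)
      map_update_add' := by
        intro _ b u x y
        refine summand_ext fun a => ?_
        simp only [LinearMap.add_apply, summandLift_pureTensor]
        simp only [substTensor, MultilinearMap.coe_mk]
        rw [subst_update_right, subst_update_right, subst_update_right,
          ← MultilinearMap.map_update_add]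
        congr 2
        exact Subtype.ext (map_add _ _ _)
      map_update_smul' := by
        intro _ b u r x
        refine summand_ext fun a => ?_
        simp only [LinearMap.smul_apply, summandLift_pureTensor]
        simp only [substTensor, MultilinearMap.coe_mk]
        rw [subst_update_right, subst_update_right, ← MultilinearMap.map_update_smul]
        congr 2
        exact Subtype.ext (map_smul _ _ _) }

/-- Composition in the PROP: on summands it is composition of surjections together with operadic
composition on each fibre. `comp ψ φ` is `ψ ∘ φ`. -/
def comp {S T U : Type} : LieHoms T U →ₗ[ℚ] LieHoms S T →ₗ[ℚ] LieHoms S U :=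
  summandDesc fun g => LinearMap.flip <| summandDesc fun f => LinearMap.flip <|
    (compTensor f.1 g.1).compr₂ (summandι ⟨g.1 ∘ f.1, g.2.comp f.2⟩)

theorem comp_summandι {S T U : Type} (g : {g : T → U // Function.Surjective g})
    (f : {f : S → T // Function.Surjective f}) (y : Summand g.1) (x : Summand f.1) :
    comp (summandι g y) (summandι f x) =
      summandι ⟨g.1 ∘ f.1, g.2.comp f.2⟩ (compTensor f.1 g.1 y x) := by
  unfold comp
  rw [summandDesc_summandι, LinearMap.flip_apply, summandDesc_summandι, LinearMap.flip_apply,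
    LinearMap.compr₂_apply]

theorem comp_elem {S T U : Type} (g : T → U) (hg : Function.Surjective g)
    (b : U → FreeLieAlgebra ℚ T) (hb : ∀ u, b u ∈ lieOn (g ⁻¹' {u}))
    (f : S → T) (hf : Function.Surjective f)
    (a : T → FreeLieAlgebra ℚ S) (ha : ∀ t, a t ∈ lieOn (f ⁻¹' {t})) :
    comp (elem g hg b hb) (elem f hf a ha) =
      elem (g ∘ f) (hg.comp hf) (fun u => FreeLieAlgebra.lift ℚ a (b u))
        (fun u => subst_mem_comp f g a ha u (hb u)) := by
  refine (comp_summandι ⟨g, hg⟩ ⟨f, hf⟩ _ _).trans ?_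
  unfold elem
  congr 1
  simp only [compTensor, summandLift_pureTensor, MultilinearMap.coe_mk]
  rfl

theorem lift_lift {S T : Type} {L : Type} [LieRing L] [LieAlgebra ℚ L]
    (a : S → L) (b : T → FreeLieAlgebra ℚ S) (x : FreeLieAlgebra ℚ T) :
    FreeLieAlgebra.lift ℚ a (FreeLieAlgebra.lift ℚ b x) =
      FreeLieAlgebra.lift ℚ (fun t => FreeLieAlgebra.lift ℚ a (b t)) x := by
  have : (FreeLieAlgebra.lift ℚ a).comp (FreeLieAlgebra.lift ℚ b) =
      FreeLieAlgebra.lift ℚ (fun t => FreeLieAlgebra.lift ℚ a (b t)) :=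
    FreeLieAlgebra.hom_ext fun t => by
      rw [LieHom.comp_apply, FreeLieAlgebra.lift_of_apply, FreeLieAlgebra.lift_of_apply]
  exact LieHom.congr_fun this x

/-- To prove that all elements of a morphism space satisfy a property closed under sums and
scalars it suffices to treat the elements `elem f a`. -/
theorem lieHoms_induction {S T : Type} {p : LieHoms S T → Prop} (φ : LieHoms S T)
    (helem : ∀ f hf a ha, p (elem f hf a ha)) (hzero : p 0)
    (hadd : ∀ φ φ', p φ → p φ' → p (φ + φ')) (hsmul : ∀ (r : ℚ) φ, p φ → p (r • φ)) : p φ := by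
  let P : Submodule ℚ (LieHoms S T) := Submodule.span ℚ {φ | ∃ f hf a ha, φ = elem f hf a ha}
  have hP : P.mkQ = 0 := lieHoms_ext fun f hf a ha => by
    rw [LinearMap.zero_apply, Submodule.mkQ_apply, Submodule.Quotient.mk_eq_zero]
    exact Submodule.subset_span ⟨f, hf, a, ha, rfl⟩
  have hφ : φ ∈ P := by
    rw [← Submodule.Quotient.mk_eq_zero, ← Submodule.mkQ_apply, hP, LinearMap.zero_apply]
  induction hφ using Submodule.span_induction with
  | mem x hx => obtain ⟨f, hf, a, ha, rfl⟩ := hx; exact helem f hf a ha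
  | zero => exact hzero
  | add x y _ _ h₁ h₂ => exact hadd x y h₁ h₂
  | smul r x _ h => exact hsmul r x h

theorem comp_assoc {S T U V : Type} (χ : LieHoms U V) (ψ : LieHoms T U) (φ : LieHoms S T) :
    comp (comp χ ψ) φ = comp χ (comp ψ φ) := by
  induction χ using lieHoms_induction with
  | hzero => simp only [map_zero, LinearMap.zero_apply]
  | hadd χ χ' h h' => simp only [map_add, LinearMap.add_apply, h, h']
  | hsmul r χ h => simp only [map_smul, LinearMap.smul_apply, h]
  | helem h hh c hc =>
  induction ψ using lieHoms_induction with
  | hzero => simp only [map_zero, LinearMap.zero_apply]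
  | hadd χ χ' h h' => simp only [map_add, LinearMap.add_apply, h, h']
  | hsmul r χ h => simp only [map_smul, LinearMap.smul_apply, h]
  | helem g hg b hb =>
  induction φ using lieHoms_induction with
  | hzero => simp only [map_zero]
  | hadd χ χ' h h' => simp only [map_add, h, h']
  | hsmul r χ h => simp only [map_smul, h]
  | helem f hf a ha =>
  simp only [comp_elem]
  exact elem_congr rfl (funext fun v => lift_lift _ _ _) _ _ _ _

/-- The morphism given by a bijection. -/
def perm {S T : Type} (e : S ≃ T) : LieHoms S T :=
  elem e e.surjective (fun t => FreeLieAlgebra.of ℚ (e.symm t))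
    (fun t => of_mem_lieOn _ (by ext s; simp [Equiv.eq_symm_apply]))

theorem comp_perm_perm {S T U : Type} (e : S ≃ T) (e' : T ≃ U) :
    comp (perm e') (perm e) = perm (e.trans e') := by
  rw [perm, perm, comp_elem]
  exact elem_congr rfl (funext fun u => FreeLieAlgebra.lift_of_apply ..) _ _ _ _

theorem comp_perm_refl {S T : Type} (φ : LieHoms S T) : comp φ (perm (Equiv.refl S)) = φ := by
  induction φ using lieHoms_induction with
  | hzero => simp only [map_zero, LinearMap.zero_apply]
  | hadd χ χ' h h' => simp only [map_add, LinearMap.add_apply, h, h']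
  | hsmul r χ h => simp only [map_smul, LinearMap.smul_apply, h]
  | helem f hf a ha =>
  rw [perm, comp_elem]
  refine elem_congr rfl (funext fun t => ?_) _ _ _ _
  have : FreeLieAlgebra.lift ℚ (FreeLieAlgebra.of ℚ (X := S)) = LieHom.id :=
    FreeLieAlgebra.hom_ext fun x => FreeLieAlgebra.lift_of_apply ..
  exact LieHom.congr_fun this (a t)

theorem perm_refl_comp {S T : Type} (φ : LieHoms S T) : comp (perm (Equiv.refl T)) φ = φ := by
  induction φ using lieHoms_induction with
  | hzero => simp only [map_zero]
  | hadd χ χ' h h' => simp only [map_add, h, h']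
  | hsmul r χ h => simp only [map_smul, h]
  | helem f hf a ha =>
  rw [perm, comp_elem]
  exact elem_congr rfl (funext fun t => FreeLieAlgebra.lift_of_apply ..) _ _ _ _

/-! ### The functor `- ⊞ 1` -/

/-- The map of free Lie algebras induced by a map of alphabets. -/
def relabel {S T : Type} (i : S → T) : FreeLieAlgebra ℚ S →ₗ⁅ℚ⁆ FreeLieAlgebra ℚ T :=
  FreeLieAlgebra.lift ℚ fun s => FreeLieAlgebra.of ℚ (i s)

theorem relabel_of {S T : Type} (i : S → T) (s : S) :
    relabel i (FreeLieAlgebra.of ℚ s) = FreeLieAlgebra.of ℚ (i s) :=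
  FreeLieAlgebra.lift_of_apply ..

theorem lift_relabel {S T : Type} {L : Type} [LieRing L] [LieAlgebra ℚ L]
    (i : S → T) (a : T → L) (x : FreeLieAlgebra ℚ S) :
    FreeLieAlgebra.lift ℚ a (relabel i x) = FreeLieAlgebra.lift ℚ (fun s => a (i s)) x := by
  unfold relabel
  rw [lift_lift]
  simp only [FreeLieAlgebra.lift_of_apply]

theorem relabel_lift {S T U : Type} (i : S → T) (a : U → FreeLieAlgebra ℚ S)
    (x : FreeLieAlgebra ℚ U) :
    relabel i (FreeLieAlgebra.lift ℚ a x) = FreeLieAlgebra.lift ℚ (fun u => relabel i (a u)) x :=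
  lift_lift ..

theorem relabel_mem {S T : Type} (i : S → T) (hi : Function.Injective i) {A : Set S} {B : Set T}
    (hB : B = i '' A) {x : FreeLieAlgebra ℚ S} (hx : x ∈ lieOn A) : relabel i x ∈ lieOn B := by
  subst hB
  induction hx using Submodule.span_induction with
  | mem x hx =>
    induction hx with
    | of s => rw [relabel_of]; exact of_mem_lieOn _ Set.image_singleton
    | bracket hAB _ _ h₁ h₂ =>
      rw [LieHom.map_lie, Set.image_union]
      exact lie_mem_lieOn ((Set.disjoint_image_iff hi).2 hAB) h₁ h₂
  | zero => rw [map_zero]; exact zero_mem _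
  | add x y _ _ h₁ h₂ => rw [map_add]; exact add_mem h₁ h₂
  | smul r x _ h => rw [map_smul]; exact Submodule.smul_mem _ _ h

theorem preimage_optionMap_some {S T : Type} (f : S → T) (t : T) :
    Option.map f ⁻¹' {some t} = some '' (f ⁻¹' {t}) := by
  ext s
  cases s <;> simp

theorem preimage_optionMap_none {S T : Type} (f : S → T) :
    Option.map f ⁻¹' {none} = {none} := by
  ext s
  cases s <;> simp

theorem optionMap_surjective {S T : Type} {f : S → T} (hf : Function.Surjective f) :
    Function.Surjective (Option.map f) := by
  rintro (_ | t)
  · exact ⟨none, rfl⟩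
  · obtain ⟨s, rfl⟩ := hf t
    exact ⟨some s, rfl⟩

/-- The family of Lie elements representing `φ ⊞ 1`: the new input is sent to the new output. -/
def boxFamily {S T : Type} (a : T → FreeLieAlgebra ℚ S) : Option T → FreeLieAlgebra ℚ (Option S)
  | none => FreeLieAlgebra.of ℚ none
  | some t => relabel some (a t)

theorem boxFamily_mem {S T : Type} (f : S → T) (a : T → FreeLieAlgebra ℚ S)
    (ha : ∀ t, a t ∈ lieOn (f ⁻¹' {t})) :
    ∀ o, boxFamily a o ∈ lieOn (Option.map f ⁻¹' {o})
  | none => of_mem_lieOn _ (preimage_optionMap_none f)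
  | some t => relabel_mem some (Option.some_injective S) (preimage_optionMap_some f t) (ha t)

/-- `boxFamily` with values in the multilinear parts. -/
def boxFamily' {S T : Type} (f : S → T) (a : ∀ t, lieOn (f ⁻¹' {t})) (o : Option T) :
    lieOn (Option.map f ⁻¹' {o}) :=
  ⟨boxFamily (fun t => (a t : FreeLieAlgebra ℚ S)) o, boxFamily_mem f _ (fun t => (a t).2) o⟩

theorem boxFamily'_update {S T : Type} [DecidableEq T] (f : S → T)
    (a : ∀ t, lieOn (f ⁻¹' {t})) (t : T) (z : lieOn (f ⁻¹' {t})) :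
    boxFamily' f (Function.update a t z) = Function.update (boxFamily' f a) (some t)
      ⟨relabel some (z : FreeLieAlgebra ℚ S),
        relabel_mem some (Option.some_injective S) (preimage_optionMap_some f t) z.2⟩ := by
  funext o
  refine Subtype.ext ?_
  rcases o with _ | t'
  · rw [Function.update_of_ne (by simp)]
    rfl
  · rcases eq_or_ne t' t with rfl | h
    · rw [Function.update_self]
      simp only [boxFamily', boxFamily, Function.update_self]
    · rw [Function.update_of_ne (by simpa using h)]
      simp only [boxFamily', boxFamily, Function.update_of_ne h]

/-- The linear map `φ ↦ φ ⊞ 1` from `CatLie(S, T)` to `CatLie(S ⨿ 1, T ⨿ 1)`. -/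
def box {S T : Type} : LieHoms S T →ₗ[ℚ] LieHoms (Option S) (Option T) :=
  summandDesc fun f => summandι ⟨Option.map f.1, optionMap_surjective f.2⟩ ∘ₗ summandLift
    { toFun := fun a => pureTensor (Option.map f.1) (boxFamily' f.1 a)
      map_update_add' := by
        classical
        intro _ a t x y
        rw [boxFamily'_update, boxFamily'_update, boxFamily'_update,
          ← MultilinearMap.map_update_add]
        congr 2
        exact Subtype.ext (map_add _ _ _)
      map_update_smul' := by
        classical
        intro _ a t r x
        rw [boxFamily'_update, boxFamily'_update, ← MultilinearMap.map_update_smul]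
        congr 2
        exact Subtype.ext (map_smul _ _ _) }

theorem box_elem {S T : Type} (f : S → T) (hf : Function.Surjective f)
    (a : T → FreeLieAlgebra ℚ S) (ha : ∀ t, a t ∈ lieOn (f ⁻¹' {t})) :
    box (elem f hf a ha) = elem (Option.map f) (optionMap_surjective hf) (boxFamily a)
      (boxFamily_mem f a ha) := by
  unfold box elem
  rw [summandDesc_summandι, LinearMap.comp_apply, summandLift_pureTensor]
  rfl

theorem box_comp {S T U : Type} (ψ : LieHoms T U) (φ : LieHoms S T) :
    box (comp ψ φ) = comp (box ψ) (box φ) := by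
  induction ψ using lieHoms_induction with
  | hzero => simp only [map_zero, LinearMap.zero_apply]
  | hadd χ χ' h h' => simp only [map_add, LinearMap.add_apply, h, h']
  | hsmul r χ h => simp only [map_smul, LinearMap.smul_apply, h]
  | helem g hg b hb =>
  induction φ using lieHoms_induction with
  | hzero => simp only [map_zero]
  | hadd χ χ' h h' => simp only [map_add, h, h']
  | hsmul r χ h => simp only [map_smul, h]
  | helem f hf a ha =>
  simp only [comp_elem, box_elem]
  refine elem_congr (Option.map_comp_map f g).symm (funext fun o => ?_) _ _ _ _
  rcases o with _ | u
  · exact (FreeLieAlgebra.lift_of_apply (boxFamily a) none).symm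
  · exact (relabel_lift ..).trans (lift_relabel some (boxFamily a) (b u)).symm

theorem box_perm {S T : Type} (e : S ≃ T) : box (perm e) = perm (Equiv.optionCongr e) := by
  unfold perm
  rw [box_elem]
  refine elem_congr rfl (funext fun o => ?_) _ _ _ _
  rcases o with _ | t
  · rfl
  · exact relabel_of ..

/-! ### The morphisms `μ(n)` -/

/-- The map `T ⨿ 1 → T` which is the identity on `T` and sends the new point to `t`. -/
def fold {T : Type} (t : T) : Option T → T := fun o => o.elim t id

theorem fold_surjective {T : Type} (t : T) : Function.Surjective (fold t) :=
  fun t' => ⟨some t', rfl⟩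

open Classical in
/-- The generator of the summand of `CatLie(T ⨿ 1, T)` indexed by `fold t`: the bracket
`[t, *]` at `t`, where `*` is the new point, and the identity elsewhere. -/
def muFamily {T : Type} (t : T) : T → FreeLieAlgebra ℚ (Option T) := fun t' =>
  if t' = t then ⁅FreeLieAlgebra.of ℚ (some t), FreeLieAlgebra.of ℚ none⁆
  else FreeLieAlgebra.of ℚ (some t')

theorem muFamily_mem {T : Type} (t : T) (t' : T) : muFamily t t' ∈ lieOn (fold t ⁻¹' {t'}) := by
  unfold muFamily
  split_ifs with h
  · subst h
    have : fold t' ⁻¹' {t'} = {some t'} ∪ {none} := by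
      ext o; cases o <;> simp [fold]
    rw [this]
    exact lie_mem_lieOn (by simp) (of_mem_lieOn _ rfl) (of_mem_lieOn _ rfl)
  · refine of_mem_lieOn _ ?_
    ext o
    cases o with
    | none => simpa [fold] using fun h' : t = t' => h h'.symm
    | some s => simp [fold]

/-- The element `μ = ∑_t μ_{fold t} ∈ CatLie(T ⨿ 1, T)`, the sum over all surjections
`T ⨿ 1 ↠ T` restricting to the identity on `T`. -/
def mu (T : Type) [Fintype T] : LieHoms (Option T) T :=
  ∑ t : T, elem (fold t) (fold_surjective t) (muFamily t) (muFamily_mem t)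

theorem lift_muFamily_of_notMem {S : Type} (s : S) {B : Set S} (hs : s ∉ B)
    {b : FreeLieAlgebra ℚ S} (hb : b ∈ lieOn B) :
    FreeLieAlgebra.lift ℚ (muFamily s) b = relabel some b := by
  refine subst_congr (fun t ht => ?_) hb
  exact if_neg fun h : t = s => hs (h ▸ ht)

/-- The bracket with a new letter is a derivation. -/
theorem sum_lift_muFamily {S : Type} [Fintype S] {B : Set S} {b : FreeLieAlgebra ℚ S}
    (hb : b ∈ lieOn B) :
    ∑ s : S, B.indicator (fun s => FreeLieAlgebra.lift ℚ (muFamily s) b) s =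
      ⁅relabel some b, FreeLieAlgebra.of ℚ none⁆ := by
  induction hb using Submodule.span_induction with
  | mem x hx =>
    induction hx with
    | of s =>
      rw [Finset.sum_eq_single s (fun t _ (ht : t ≠ s) => Set.indicator_of_notMem
          (s := {s}) (by simpa using ht) _) (fun h => absurd (Finset.mem_univ s) h),
        Set.indicator_of_mem (Set.mem_singleton s), FreeLieAlgebra.lift_of_apply, relabel_of]
      exact if_pos rfl
    | @bracket A B x y hAB hx hy h₁ h₂ =>
      have hsum : ∀ s : S,
          (A ∪ B).indicator (fun s => FreeLieAlgebra.lift ℚ (muFamily s) ⁅x, y⁆) s =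
          ⁅A.indicator (fun s => FreeLieAlgebra.lift ℚ (muFamily s) x) s, relabel some y⁆ +
          ⁅relabel some x, B.indicator (fun s => FreeLieAlgebra.lift ℚ (muFamily s) y) s⁆ := by
        intro s
        by_cases hA : s ∈ A
        · have hB : s ∉ B := Set.disjoint_left.1 hAB hA
          rw [Set.indicator_of_mem (Set.mem_union_left B hA), Set.indicator_of_mem hA,
            Set.indicator_of_notMem hB, lie_zero, add_zero, LieHom.map_lie,
            lift_muFamily_of_notMem s hB hy.mem]
        · by_cases hB : s ∈ B
          · rw [Set.indicator_of_mem (Set.mem_union_right A hB), Set.indicator_of_notMem hA,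
              Set.indicator_of_mem hB, zero_lie, zero_add, LieHom.map_lie,
              lift_muFamily_of_notMem s hA hx.mem]
          · rw [Set.indicator_of_notMem (fun h : s ∈ A ∪ B => h.elim hA hB),
              Set.indicator_of_notMem hA, Set.indicator_of_notMem hB, zero_lie, lie_zero, add_zero]
      rw [Finset.sum_congr rfl fun s _ => hsum s, Finset.sum_add_distrib, ← sum_lie,
        ← lie_sum, h₁, h₂, LieHom.map_lie, lie_lie]
      rw [← lie_skew (relabel some y) (FreeLieAlgebra.of ℚ none), lie_neg,
        ← lie_skew ⁅relabel some x, relabel some y⁆ (FreeLieAlgebra.of ℚ none)]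
      abel
  | zero => simp only [map_zero, zero_lie, Set.indicator_zero, Finset.sum_const_zero]
  | add x y _ _ h₁ h₂ =>
    rw [map_add, add_lie, ← h₁, ← h₂, ← Finset.sum_add_distrib]
    refine Finset.sum_congr rfl fun s _ => ?_
    by_cases hs : s ∈ B
    · simp only [Set.indicator_of_mem hs, map_add]
    · simp only [Set.indicator_of_notMem hs, add_zero]
  | smul r x _ h =>
    rw [map_smul, smul_lie, ← h, Finset.smul_sum]
    refine Finset.sum_congr rfl fun s _ => ?_
    by_cases hs : s ∈ B
    · simp only [Set.indicator_of_mem hs, map_smul]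
    · simp only [Set.indicator_of_notMem hs, smul_zero]

/-- Additivity of `elem` in one tensor factor. -/
theorem sum_elem_update {S T : Type} [DecidableEq T] {ι : Type} (I : Finset ι) (f : S → T)
    (hf : Function.Surjective f) (a : T → FreeLieAlgebra ℚ S)
    (t : T) (ha : ∀ t', t' ≠ t → a t' ∈ lieOn (f ⁻¹' {t'}))
    (v : ι → FreeLieAlgebra ℚ S) (hv : ∀ i ∈ I, v i ∈ lieOn (f ⁻¹' {t}))
    (F : ι → LieHoms S T)
    (hF : ∀ i ∈ I, ∀ h, F i = elem f hf (Function.update a t (v i)) h)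
    (h : ∀ t', Function.update a t (∑ i ∈ I, v i) t' ∈ lieOn (f ⁻¹' {t'})) :
    ∑ i ∈ I, F i = elem f hf (Function.update a t (∑ i ∈ I, v i)) h := by
  have hmem : ∀ z, z ∈ lieOn (f ⁻¹' {t}) →
      ∀ t', Function.update a t z t' ∈ lieOn (f ⁻¹' {t'}) := by
    intro z hz t'
    rcases eq_or_ne t' t with rfl | h'
    · rwa [Function.update_self]
    · rw [Function.update_of_ne h']; exact ha t' h'
  let a' : ∀ t', lieOn (f ⁻¹' {t'}) := fun t' => ⟨Function.update a t 0 t', hmem 0 (zero_mem _) t'⟩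
  have key : ∀ z (hz : z ∈ lieOn (f ⁻¹' {t})), elem f hf (Function.update a t z) (hmem z hz) =
      summandι ⟨f, hf⟩ (pureTensor f (Function.update a' t ⟨z, hz⟩)) := by
    intro z hz
    unfold elem
    congr 2
    funext t'
    refine Subtype.ext ?_
    rcases eq_or_ne t' t with rfl | h'
    · simp only [Function.update_self]
    · simp only [Function.update_of_ne h', a']
  have hsum : ∑ i ∈ I, v i ∈ lieOn (f ⁻¹' {t}) := sum_mem hv
  rw [key _ hsum]
  have : (⟨∑ i ∈ I, v i, hsum⟩ : lieOn (f ⁻¹' {t})) =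
      ∑ i ∈ I.attach, ⟨v i, hv i i.2⟩ := by
    refine Subtype.ext ?_
    rw [AddSubmonoidClass.coe_finsetSum]
    exact (Finset.sum_attach I v).symm
  rw [this, MultilinearMap.map_update_sum, map_sum, ← Finset.sum_attach]
  refine Finset.sum_congr rfl fun i _ => ?_
  rw [hF i i.2 (hmem _ (hv i i.2)), key _ (hv i i.2)]

/-- The centrality property `φ ∘ μ = μ ∘ (φ ⊞ 1)`. -/
theorem comp_mu {S T : Type} [Fintype S] [Fintype T] (φ : LieHoms S T) :
    comp φ (mu S) = comp (mu T) (box φ) := by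
  classical
  induction φ using lieHoms_induction with
  | hzero => simp only [map_zero, LinearMap.zero_apply]
  | hadd χ χ' h h' => simp only [map_add, LinearMap.add_apply, h, h']
  | hsmul r χ h => simp only [map_smul, LinearMap.smul_apply, h]
  | helem f hf b hb =>
  unfold mu
  rw [map_sum, map_sum, LinearMap.sum_apply, box_elem]
  rw [← Finset.sum_fiberwise (s := Finset.univ) (g := f)]
  refine Finset.sum_congr rfl fun t _ => ?_
  have hfold : ∀ s ∈ Finset.univ.filter (fun s => f s = t), f ∘ fold s = fold t ∘ Option.map f := by
    intro s hs
    have hs : f s = t := by simpa using hs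
    funext o
    cases o with
    | none => exact hs
    | some s' => rfl
  have hb' : ∑ s ∈ Finset.univ.filter (fun s => f s = t), FreeLieAlgebra.lift ℚ (muFamily s) (b t) =
      ⁅relabel some (b t), FreeLieAlgebra.of ℚ none⁆ := by
    rw [Finset.sum_filter, ← sum_lift_muFamily (hb t)]
    refine Finset.sum_congr rfl fun s _ => ?_
    rw [Set.indicator_apply]
    rfl
  have hfam : (fun u => FreeLieAlgebra.lift ℚ (boxFamily b) (muFamily t u)) =
      Function.update (fun u => relabel some (b u)) t
        (∑ s ∈ Finset.univ.filter (fun s => f s = t),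
          FreeLieAlgebra.lift ℚ (muFamily s) (b t)) := by
    funext u
    rw [hb']
    unfold muFamily
    rcases eq_or_ne u t with rfl | h
    · rw [Function.update_self, if_pos rfl, LieHom.map_lie, FreeLieAlgebra.lift_of_apply,
        FreeLieAlgebra.lift_of_apply]
      rfl
    · rw [Function.update_of_ne h, if_neg h, FreeLieAlgebra.lift_of_apply]
      rfl
  have hcomp : Function.Surjective (fold t ∘ Option.map f) :=
    (fold_surjective t).comp (optionMap_surjective hf)
  rw [comp_elem, elem_congr rfl hfam _ hcomp _ (by
    rw [← hfam]
    exact fun u => subst_mem_comp _ _ _ (boxFamily_mem f b hb) _ (muFamily_mem t u))]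
  refine sum_elem_update _ _ hcomp _ t ?_ _ ?_ _ ?_ _
  · intro u hu
    refine relabel_mem some (Option.some_injective S) ?_ (hb u)
    ext o
    cases o with
    | none => simpa [fold] using fun h : t = u => hu h.symm
    | some s => simp [fold]
  · intro s hs
    rw [← hfold s hs]
    exact subst_mem_comp _ _ _ (muFamily_mem s) _ (hb t)
  · intro s hs h
    rw [comp_elem]
    refine elem_congr (hfold s hs) (funext fun u => ?_) _ _ _ _
    rcases eq_or_ne u t with rfl | hu
    · rw [Function.update_self]
    · rw [Function.update_of_ne hu]
      refine lift_muFamily_of_notMem s (B := f ⁻¹' {u}) (fun h' => hu ?_) (hb u)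
      have hs : f s = t := by simpa using hs
      exact h'.symm.trans hs

/-! ### The category `CatLie` -/

/-- The `ℚ`-linear category `CatLie`, with set of objects `ℕ`. -/
structure CatLie : Type where
  /-- the underlying natural number -/
  n : ℕ

instance : Category CatLie where
  Hom X Y := LieHoms (Fin X.n) (Fin Y.n)
  id X := perm (Equiv.refl (Fin X.n))
  comp φ ψ := comp ψ φ
  id_comp φ := comp_perm_refl φ
  comp_id φ := perm_refl_comp φ
  assoc φ ψ χ := (comp_assoc χ ψ φ).symm

theorem comp_add_right {S T U : Type} (ψ : LieHoms T U) (φ φ' : LieHoms S T) :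
    comp ψ (φ + φ') = comp ψ φ + comp ψ φ' := map_add ..

theorem comp_add_left {S T U : Type} (ψ ψ' : LieHoms T U) (φ : LieHoms S T) :
    comp (ψ + ψ') φ = comp ψ φ + comp ψ' φ := by
  rw [map_add, LinearMap.add_apply]

theorem comp_smul_right {S T U : Type} (r : ℚ) (ψ : LieHoms T U) (φ : LieHoms S T) :
    comp ψ (r • φ) = r • comp ψ φ := map_smul ..

theorem comp_smul_left {S T U : Type} (r : ℚ) (ψ : LieHoms T U) (φ : LieHoms S T) :
    comp (r • ψ) φ = r • comp ψ φ := by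
  rw [map_smul, LinearMap.smul_apply]

instance : Preadditive CatLie where
  homGroup X Y := inferInstanceAs (AddCommGroup (LieHoms (Fin X.n) (Fin Y.n)))
  add_comp X Y Z φ φ' ψ :=
    comp_add_right (S := Fin X.n) (T := Fin Y.n) (U := Fin Z.n) ψ φ φ'
  comp_add X Y Z φ ψ ψ' :=
    comp_add_left (S := Fin X.n) (T := Fin Y.n) (U := Fin Z.n) ψ ψ' φ

instance : Linear ℚ CatLie where
  homModule X Y := inferInstanceAs (Module ℚ (LieHoms (Fin X.n) (Fin Y.n)))
  smul_comp X Y Z r φ ψ :=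
    comp_smul_right (S := Fin X.n) (T := Fin Y.n) (U := Fin Z.n) r ψ φ
  comp_smul X Y Z φ r ψ :=
    comp_smul_left (S := Fin X.n) (T := Fin Y.n) (U := Fin Z.n) r ψ φ

/-- The functor `- ⊞ 1 : CatLie ⥤ CatLie`, identifying `Fin (n + 1)` with `Fin n ⨿ 1`. -/
def boxOne : CatLie ⥤ CatLie where
  obj X := ⟨X.n + 1⟩
  map {X Y} φ := comp (perm (finSuccEquivLast (n := Y.n)).symm)
    (comp (box φ) (perm (finSuccEquivLast (n := X.n))))
  map_id X := by
    change comp _ (comp (box (perm _)) _) = perm _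
    rw [box_perm, comp_perm_perm, comp_perm_perm]
    congr 1
    ext i
    simp
  map_comp {X Y Z} φ ψ := by
    change comp _ (comp (box (comp ψ φ)) _) = comp (comp _ (comp (box ψ) _)) (comp _ (comp (box φ) _))
    rw [box_comp]
    simp only [comp_assoc]
    rw [← comp_assoc (perm finSuccEquivLast) (perm finSuccEquivLast.symm), comp_perm_perm,
      Equiv.symm_trans_self, perm_refl_comp]

instance : boxOne.Additive where
  map_add {X Y φ φ'} := by
    change comp _ (comp (box (_ + _)) _) = comp _ _ + comp _ _
    rw [map_add, map_add, LinearMap.add_apply, map_add]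
    rfl

instance : boxOne.Linear ℚ where
  map_smul {X Y} φ r := by
    change comp _ (comp (box (_ • _)) _) = _ • comp _ _
    rw [map_smul, map_smul, LinearMap.smul_apply, map_smul]
    rfl

/-- The morphism `μ(n) ∈ CatLie(n + 1, n)`: the sum of the `μ_f(n)`, over the surjections `f` from
`{1, …, n + 1}` onto `{1, …, n}` which restrict to the identity of `{1, …, n}`. -/
def muN (X : CatLie) : boxOne.obj X ⟶ X :=
  (comp (mu (Fin X.n)) (perm (finSuccEquivLast (n := X.n))) :
    LieHoms (Fin (X.n + 1)) (Fin X.n))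

theorem comp_mu_fin {m n : ℕ} (φ : LieHoms (Fin m) (Fin n)) :
    comp (comp (mu (Fin n)) (perm finSuccEquivLast))
      (comp (perm finSuccEquivLast.symm) (comp (box φ) (perm finSuccEquivLast))) =
    comp φ (comp (mu (Fin m)) (perm finSuccEquivLast)) := by
  rw [comp_assoc, ← comp_assoc (perm finSuccEquivLast) (perm finSuccEquivLast.symm),
    comp_perm_perm, Equiv.symm_trans_self, perm_refl_comp, ← comp_assoc, ← comp_mu, comp_assoc]

theorem boxOne_map_muN {X Y : CatLie} (φ : X ⟶ Y) : boxOne.map φ ≫ muN Y = muN X ≫ φ :=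
  comp_mu_fin (m := X.n) (n := Y.n) φ

/-! ### Right `ℚΣ`-modules and their convolution product -/

/-- The category `Σ` of finite sets and bijections. -/
structure FinBij : Type 1 where
  /-- the underlying set -/
  carrier : Type
  /-- the underlying set is finite -/
  finite : Finite carrier

instance : Category FinBij where
  Hom S T := S.carrier ≃ T.carrier
  id S := Equiv.refl S.carrier
  comp e e' := Equiv.trans e e'

/-- The bijection of sets underlying a morphism of `Σ`. -/
def FinBij.toEquiv {S T : FinBij} (e : S ⟶ T) : S.carrier ≃ T.carrier := e

/-- Right `ℚΣ`-modules: functors from `Σᵒᵖ` to `ℚ`-vector spaces (equivalently, `ℚ`-linear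
functors from `ℚΣᵒᵖ`). -/
abbrev RightMod : Type 1 := FinBijᵒᵖ ⥤ ModuleCat.{0} ℚ

/-- A subset of a finite set, as a finite set. -/
def FinBij.sub (S : FinBij) (A : Set S.carrier) : FinBij :=
  ⟨A, have := S.finite; inferInstance⟩

/-- A bijection `e : S ≃ T` restricts to `e⁻¹(B) ≃ B` for each subset `B` of `T`. -/
def FinBij.restrict {S T : FinBij} (e : S ⟶ T) (B : Set T.carrier) :
    S.sub (FinBij.toEquiv e ⁻¹' B) ⟶ T.sub B :=
  (FinBij.toEquiv e).subtypeEquiv fun _ => Iff.rfl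

/-- The underlying vector space of the convolution product,
`(M ⊙ N)(S) = ⨁_{S = S₁ ⨿ S₂} M(S₁) ⊗ N(S₂)`. An ordered decomposition `S = S₁ ⨿ S₂` is the same
thing as the subset `S₁`, with `S₂` its complement. -/
abbrev ConvSpace (M N : RightMod) (S : FinBij) : Type :=
  ⨁ A : Set S.carrier,
    (M.obj (Opposite.op (S.sub A)) : Type) ⊗[ℚ] (N.obj (Opposite.op (S.sub Aᶜ)) : Type)

open Classical in
/-- The inclusion of the summand of the convolution product indexed by `A`. -/
def convι (M N : RightMod) (S : FinBij) (A : Set S.carrier) :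
    (M.obj (Opposite.op (S.sub A)) : Type) ⊗[ℚ] (N.obj (Opposite.op (S.sub Aᶜ)) : Type) →ₗ[ℚ]
      ConvSpace M N S :=
  DirectSum.lof ℚ _ (fun A : Set S.carrier =>
    (M.obj (Opposite.op (S.sub A)) : Type) ⊗[ℚ] (N.obj (Opposite.op (S.sub Aᶜ)) : Type)) A

open Classical in
/-- The linear map out of the convolution product with given restriction to each summand. -/
def convDesc {M N : RightMod} {S : FinBij} {V : Type} [AddCommGroup V] [Module ℚ V]
    (F : ∀ A : Set S.carrier, (M.obj (Opposite.op (S.sub A)) : Type) ⊗[ℚ]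
      (N.obj (Opposite.op (S.sub Aᶜ)) : Type) →ₗ[ℚ] V) : ConvSpace M N S →ₗ[ℚ] V :=
  DirectSum.toModule ℚ _ V F

theorem convDesc_convι {M N : RightMod} {S : FinBij} {V : Type} [AddCommGroup V] [Module ℚ V]
    (F : ∀ A : Set S.carrier, (M.obj (Opposite.op (S.sub A)) : Type) ⊗[ℚ]
      (N.obj (Opposite.op (S.sub Aᶜ)) : Type) →ₗ[ℚ] V) (A : Set S.carrier) (x) :
    convDesc F (convι M N S A x) = F A x := by
  classical
  exact DirectSum.toModule_lof ..

theorem conv_ext {M N : RightMod} {S : FinBij} {V : Type} [AddCommGroup V] [Module ℚ V]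
    {F G : ConvSpace M N S →ₗ[ℚ] V}
    (h : ∀ A x y, F (convι M N S A (x ⊗ₜ y)) = G (convι M N S A (x ⊗ₜ y))) : F = G := by
  classical
  exact DirectSum.linearMap_ext _ fun A => TensorProduct.ext' fun x y => h A x y

/-- The right `Σ`-action on the convolution product. -/
def convPull (M N : RightMod) {S T : FinBij} (e : S ⟶ T) : ConvSpace M N T →ₗ[ℚ] ConvSpace M N S :=
  convDesc fun A => convι M N S (FinBij.toEquiv e ⁻¹' A) ∘ₗ
    TensorProduct.map (M.map (FinBij.restrict e A).op).hom (N.map (FinBij.restrict e Aᶜ).op).hom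

theorem convPull_convι (M N : RightMod) {S T : FinBij} (e : S ⟶ T) (A : Set T.carrier)
    (x : M.obj (Opposite.op (T.sub A))) (y : N.obj (Opposite.op (T.sub Aᶜ))) :
    convPull M N e (convι M N T A (x ⊗ₜ y)) = convι M N S (FinBij.toEquiv e ⁻¹' A)
      ((M.map (FinBij.restrict e A).op).hom x ⊗ₜ (N.map (FinBij.restrict e Aᶜ).op).hom y) :=
  convDesc_convι _ _ _

/-- The map of convolution products induced by a map of left factors. -/
def convPush {M M' : RightMod} (α : M ⟶ M') (N : RightMod) (S : FinBij) :
    ConvSpace M N S →ₗ[ℚ] ConvSpace M' N S :=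
  convDesc fun A => convι M' N S A ∘ₗ TensorProduct.map (α.app _).hom LinearMap.id

theorem convPush_convι {M M' : RightMod} (α : M ⟶ M') (N : RightMod) (S : FinBij)
    (A : Set S.carrier) (x : M.obj (Opposite.op (S.sub A))) (y : N.obj (Opposite.op (S.sub Aᶜ))) :
    convPush α N S (convι M N S A (x ⊗ₜ y)) =
      convι M' N S A ((α.app (Opposite.op (S.sub A))).hom x ⊗ₜ y) :=
  convDesc_convι _ _ _

theorem convPull_id (M N : RightMod) (S : FinBij) : convPull M N (𝟙 S) = LinearMap.id := by
  refine conv_ext fun A x y => ?_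
  rw [convPull_convι]
  change convι M N S A ((M.map (𝟙 _)).hom x ⊗ₜ (N.map (𝟙 _)).hom y) = _
  rw [M.map_id, N.map_id]
  rfl

theorem convPull_comp (M N : RightMod) {S T U : FinBij} (e : S ⟶ T) (e' : T ⟶ U) :
    convPull M N (e ≫ e') = convPull M N e ∘ₗ convPull M N e' := by
  refine conv_ext fun A x y => ?_
  rw [LinearMap.comp_apply, convPull_convι, convPull_convι, convPull_convι]
  change convι M N S _
    ((M.map ((FinBij.restrict e' A).op ≫ (FinBij.restrict e (FinBij.toEquiv e' ⁻¹' A)).op)).hom x ⊗ₜ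
    (N.map ((FinBij.restrict e' Aᶜ).op ≫ (FinBij.restrict e (FinBij.toEquiv e' ⁻¹' Aᶜ)).op)).hom y) =
    _
  rw [M.map_comp, N.map_comp]
  rfl

theorem convPush_convPull {M M' : RightMod} (α : M ⟶ M') (N : RightMod) {S T : FinBij}
    (e : S ⟶ T) :
    convPush α N S ∘ₗ convPull M N e = convPull M' N e ∘ₗ convPush α N T := by
  refine conv_ext fun A x y => ?_
  rw [LinearMap.comp_apply, LinearMap.comp_apply, convPull_convι, convPush_convι, convPush_convι,
    convPull_convι]
  have := LinearMap.congr_fun (congrArg ModuleCat.Hom.hom (α.naturality (FinBij.restrict e A).op)) x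
  exact congrArg (fun z => convι M' N S (FinBij.toEquiv e ⁻¹' A)
    (z ⊗ₜ (N.map (FinBij.restrict e Aᶜ).op).hom y)) this

theorem convPush_id (M N : RightMod) (S : FinBij) : convPush (𝟙 M) N S = LinearMap.id := by
  refine conv_ext fun A x y => ?_
  rw [convPush_convι]
  rfl

theorem convPush_comp {M M' M'' : RightMod} (α : M ⟶ M') (β : M' ⟶ M'') (N : RightMod)
    (S : FinBij) : convPush (α ≫ β) N S = convPush β N S ∘ₗ convPush α N S := by
  refine conv_ext fun A x y => ?_
  rw [LinearMap.comp_apply, convPush_convι, convPush_convι, convPush_convι]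
  rfl

theorem convPush_add {M M' : RightMod} (α β : M ⟶ M') (N : RightMod)
    (S : FinBij) : convPush (α + β) N S = convPush α N S + convPush β N S := by
  refine conv_ext fun A x y => ?_
  rw [LinearMap.add_apply, convPush_convι, convPush_convι, convPush_convι, ← map_add,
    ← TensorProduct.add_tmul]
  rfl

theorem convPush_smul {M M' : RightMod} (r : ℚ) (α : M ⟶ M') (N : RightMod)
    (S : FinBij) : convPush (r • α) N S = r • convPush α N S := by
  refine conv_ext fun A x y => ?_
  rw [LinearMap.smul_apply, convPush_convι, convPush_convι, ← map_smul, TensorProduct.smul_tmul']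
  rfl

/-- The convolution product `M ⊙ N` of right `ℚΣ`-modules. -/
def convObj (M N : RightMod) : RightMod where
  obj S := ModuleCat.of ℚ (ConvSpace M N S.unop)
  map e := ModuleCat.ofHom (convPull M N e.unop)
  map_id S := ModuleCat.hom_ext (convPull_id M N S.unop)
  map_comp e e' := ModuleCat.hom_ext (convPull_comp M N e'.unop e.unop)

/-- The functor `- ⊙ N` on right `ℚΣ`-modules. -/
def convRight (N : RightMod) : RightMod ⥤ RightMod where
  obj M := convObj M N
  map α :=
    { app S := ModuleCat.ofHom (convPush α N S.unop)
      naturality _ _ e := ModuleCat.hom_ext (convPush_convPull α N e.unop) }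
  map_id M := NatTrans.ext (funext fun S => ModuleCat.hom_ext (convPush_id M N S.unop))
  map_comp α β := NatTrans.ext (funext fun S => ModuleCat.hom_ext (convPush_comp α β N S.unop))

instance (N : RightMod) : (convRight N).Additive where
  map_add {_ _ α β} :=
    NatTrans.ext (funext fun S => ModuleCat.hom_ext (convPush_add α β N S.unop))

instance (N : RightMod) : (convRight N).Linear ℚ where
  map_smul α r :=
    NatTrans.ext (funext fun S => ModuleCat.hom_ext (convPush_smul r α N S.unop))

open Classical in
/-- The vector space `I(S)`: it is `ℚ` if `S` has exactly one element, and `0` otherwise. -/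
def unitSpace (S : FinBij) : Submodule ℚ ℚ := if Nat.card S.carrier = 1 then ⊤ else ⊥

theorem unitSpace_congr {S T : FinBij} (e : S ⟶ T) : unitSpace T = unitSpace S := by
  unfold unitSpace
  rw [Nat.card_congr (FinBij.toEquiv e)]

/-- The right `ℚΣ`-module `I`, which is `ℚ` supported on sets with one element. -/
def unitI : RightMod where
  obj S := ModuleCat.of ℚ (unitSpace S.unop)
  map e := ModuleCat.ofHom (Submodule.inclusion (unitSpace_congr e.unop).le)

/-! ### Left `CatLie`, right `ℚΣ` bimodules -/

/-- The property of being a `ℚ`-linear functor. -/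
def isLinear : ObjectProperty (CatLie ⥤ RightMod) := fun F =>
  ∃ _ : F.Additive, F.Linear ℚ

/-- Left `CatLie`, right `ℚΣ` bimodules: `ℚ`-linear functors from `CatLie` to right
`ℚΣ`-modules. -/
abbrev Bimod : Type 1 := isLinear.FullSubcategory

theorem isLinear_iff (F : CatLie ⥤ RightMod) : isLinear F ↔
    (∀ {X Y : CatLie} (φ ψ : X ⟶ Y), F.map (φ + ψ) = F.map φ + F.map ψ) ∧
    (∀ {X Y : CatLie} (r : ℚ) (φ : X ⟶ Y), F.map (r • φ) = r • F.map φ) :=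
  ⟨fun ⟨h, h'⟩ => ⟨fun _ _ => h.map_add, fun r φ => h'.map_smul φ r⟩,
    fun ⟨h, h'⟩ => ⟨⟨h _ _⟩, ⟨fun φ r => h' r φ⟩⟩⟩

instance : isLinear.IsClosedUnderSubobjects where
  prop_of_mono {F G} i _ hG := by
    rw [isLinear_iff] at hG ⊢
    refine ⟨fun {X Y} φ ψ => ?_, fun {X Y} r φ => ?_⟩
    · rw [← cancel_mono (i.app Y)]
      simp [hG.1]
    · rw [← cancel_mono (i.app Y)]
      simp [hG.2]

instance : isLinear.IsClosedUnderQuotients where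
  prop_of_epi {F G} p _ hF := by
    rw [isLinear_iff] at hF ⊢
    refine ⟨fun {X Y} φ ψ => ?_, fun {X Y} r φ => ?_⟩
    · rw [← cancel_epi (p.app X)]
      simp only [← NatTrans.naturality, Preadditive.comp_add, hF.1, Preadditive.add_comp]
    · rw [← cancel_epi (p.app X)]
      simp only [← NatTrans.naturality, Linear.comp_smul, hF.2, Linear.smul_comp]

instance : isLinear.ContainsZero where
  exists_zero := by
    obtain ⟨Z, hZ⟩ := HasZeroObject.zero (C := CatLie ⥤ RightMod)
    exact ⟨Z, hZ, (isLinear_iff _).2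
      ⟨fun _ _ => (hZ.obj _).eq_of_src _ _, fun _ _ => (hZ.obj _).eq_of_src _ _⟩⟩

instance : isLinear.IsClosedUnderFiniteProducts where
  isClosedUnderLimitsOfShape J _ :=
    { limitsOfShape_le := by
        rintro F ⟨p⟩
        have hp : ∀ j, isLinear (p.diag.obj j) := p.prop_diag_obj
        have hext : ∀ {X Y : CatLie} (a b : F.obj X ⟶ F.obj Y),
            (∀ j, a ≫ (p.π.app j).app Y = b ≫ (p.π.app j).app Y) → a = b := fun {X Y} a b h =>
          (isLimitOfPreserves ((evaluation CatLie RightMod).obj Y) p.isLimit).hom_ext h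
        rw [isLinear_iff]
        refine ⟨fun {X Y} φ ψ => hext _ _ fun j => ?_, fun {X Y} r φ => hext _ _ fun j => ?_⟩
        · have := ((isLinear_iff _).1 (hp j)).1 φ ψ
          have h := (p.π.app j).naturality
          dsimp at h
          rw [h, Preadditive.add_comp, h, h, this, Preadditive.comp_add]
        · have := ((isLinear_iff _).1 (hp j)).2 r φ
          have h := (p.π.app j).naturality
          dsimp at h
          rw [h, Linear.smul_comp, h, this, Linear.comp_smul] }

instance : Abelian Bimod := inferInstance


/-- `CatLie` as a left `CatLie`, right `ℚΣ` bimodule: a bijection `e : S' ≃ S` acts on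
`CatLie(S, n)` by precomposition, and `CatLie(n, n')` acts by postcomposition. -/
def catLieFunctor : CatLie ⥤ RightMod where
  obj X :=
    { obj S := ModuleCat.of ℚ (LieHoms S.unop.carrier (Fin X.n))
      map e := ModuleCat.ofHom (comp.flip (perm (FinBij.toEquiv e.unop)))
      map_id _ := ModuleCat.hom_ext (LinearMap.ext fun φ => comp_perm_refl φ)
      map_comp e e' := ModuleCat.hom_ext (LinearMap.ext fun φ =>
        ((comp_assoc φ (perm (FinBij.toEquiv e.unop)) (perm (FinBij.toEquiv e'.unop))).trans
          (congrArg (comp φ) (comp_perm_perm _ _))).symm) }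
  map {X Y} ψ :=
    { app _ := ModuleCat.ofHom (comp (ψ : LieHoms (Fin X.n) (Fin Y.n)))
      naturality _ _ _ := ModuleCat.hom_ext (LinearMap.ext fun φ =>
        (comp_assoc (ψ : LieHoms (Fin X.n) (Fin Y.n)) φ _).symm) }
  map_id _ := NatTrans.ext (funext fun _ => ModuleCat.hom_ext (LinearMap.ext fun φ =>
    perm_refl_comp φ))
  map_comp {X Y Z} ψ χ := NatTrans.ext (funext fun _ => ModuleCat.hom_ext (LinearMap.ext fun φ =>
    comp_assoc (χ : LieHoms (Fin Y.n) (Fin Z.n)) (ψ : LieHoms (Fin X.n) (Fin Y.n)) φ))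

theorem isLinear_catLieFunctor : isLinear catLieFunctor :=
  (isLinear_iff _).2
    ⟨fun {X Y} ψ ψ' => NatTrans.ext (funext fun S => ModuleCat.hom_ext
      (map_add (comp (S := S.unop.carrier) (T := Fin X.n) (U := Fin Y.n)) ψ ψ')),
    fun {X Y} r ψ => NatTrans.ext (funext fun S => ModuleCat.hom_ext
      (map_smul (comp (S := S.unop.carrier) (T := Fin X.n) (U := Fin Y.n)) r ψ))⟩

/-- The bimodule `CatLie`. -/
def catLie : Bimod := ⟨catLieFunctor, isLinear_catLieFunctor⟩

theorem isLinear_comp_convRight {F : CatLie ⥤ RightMod} (hF : isLinear F) (N : RightMod) :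
    isLinear (F ⋙ convRight N) := by
  obtain ⟨_, _⟩ := hF
  exact ⟨inferInstance, inferInstance⟩

theorem isLinear_boxOne_comp {F : CatLie ⥤ RightMod} (hF : isLinear F) :
    isLinear (boxOne ⋙ F) := by
  obtain ⟨_, _⟩ := hF
  exact ⟨inferInstance, inferInstance⟩

/-- The convolution product `B ⊙ N` of a bimodule with a right `ℚΣ`-module. -/
def convBimod (B : Bimod) (N : RightMod) : Bimod :=
  ⟨B.obj ⋙ convRight N, isLinear_comp_convRight B.property N⟩

/-- The functor `δ` on objects: restriction along `- ⊞ 1`. -/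
def delta (B : Bimod) : Bimod := ⟨boxOne ⋙ B.obj, isLinear_boxOne_comp B.property⟩

/-- The natural transformation `μ̃ : δ ⟶ Id`, given by the left action of the `μ(n)`. -/
def muTilde (B : Bimod) : delta B ⟶ B :=
  ObjectProperty.homMk
    { app X := B.obj.map (muN X)
      naturality X Y φ := by
        change B.obj.map (boxOne.map φ) ≫ B.obj.map (muN Y) = B.obj.map (muN X) ≫ B.obj.map φ
        rw [← B.obj.map_comp, ← B.obj.map_comp, boxOne_map_muN] }

/-! ### The inclusion of `CatLie ⊙ I` in `δ CatLie` -/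

theorem exists_splitEquiv {S : Type} (A : Set S) (h : Nat.card ↑Aᶜ = 1) :
    ∃ σ : S ≃ Option A, ∀ x : A, σ x = some x := by
  classical
  obtain ⟨a, ha⟩ := Set.ncard_eq_one.1 (show Aᶜ.ncard = 1 from h)
  have haA : a ∉ A := (ha ▸ Set.mem_singleton a : a ∈ Aᶜ)
  have hA : ∀ x, x ∉ A → x = a := fun x hx => (ha ▸ hx : x ∈ ({a} : Set S))
  refine ⟨⟨fun x => if hx : x ∈ A then some ⟨x, hx⟩ else none, fun o => o.elim a (↑), ?_, ?_⟩, ?_⟩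
  · intro x
    by_cases hx : x ∈ A
    · simp [hx]
    · simp only [dif_neg hx]
      exact (hA x hx).symm
  · rintro (_ | x)
    · simp [haA]
    · simp
  · intro x
    simp

/-- For a subset `A` of `S` whose complement is one point, the bijection of `S` with `A ⨿ 1` which
is the identity on `A`. -/
def splitEquiv {S : Type} (A : Set S) (h : Nat.card ↑Aᶜ = 1) : S ≃ Option A :=
  (exists_splitEquiv A h).choose

theorem splitEquiv_unique {S : Type} (A : Set S) (h : Nat.card ↑Aᶜ = 1) (σ : S ≃ Option A)
    (hσ : ∀ x : A, σ x = some x) : σ = splitEquiv A h := by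
  have h' := (exists_splitEquiv A h).choose_spec
  have key : ∀ (τ : S ≃ Option A), (∀ x : A, τ x = some x) → ∀ x, x ∉ A → τ x = none := by
    intro τ hτ x hx
    by_contra hne
    obtain ⟨y, hy⟩ := Option.ne_none_iff_exists'.1 hne
    exact hx (τ.injective (hy.trans (hτ y).symm) ▸ y.2)
  refine Equiv.ext fun x => ?_
  by_cases hx : x ∈ A
  · exact (hσ ⟨x, hx⟩).trans (h' ⟨x, hx⟩).symm
  · exact (key σ hσ x hx).trans (key _ h' x hx).symm

open Classical in
/-- The restriction of the map `CatLie(-, n) ⊙ I → CatLie(-, n + 1)` to the summand indexed by `A`.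
If `S = A ⨿ {s}` it is `φ ⊗ r ↦ r (φ ⊞ 1)`. -/
def convToDeltaSummand (n : ℕ) (S : FinBij) (A : Set S.carrier) :
    LieHoms A (Fin n) ⊗[ℚ] unitSpace (S.sub Aᶜ) →ₗ[ℚ] LieHoms S.carrier (Fin (n + 1)) :=
  if h : Nat.card ↑Aᶜ = 1 then
    TensorProduct.lift (LinearMap.flip (LinearMap.toSpanSingleton ℚ _
      ((comp (perm (finSuccEquivLast (n := n)).symm)) ∘ₗ (comp.flip (perm (splitEquiv A h))) ∘ₗ box)
      ∘ₗ (unitSpace (S.sub Aᶜ)).subtype))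
  else 0

theorem convToDeltaSummand_tmul (n : ℕ) (S : FinBij) (A : Set S.carrier) (h : Nat.card ↑Aᶜ = 1)
    (φ : LieHoms A (Fin n)) (r : unitSpace (S.sub Aᶜ)) :
    convToDeltaSummand n S A (φ ⊗ₜ r) = (r : ℚ) • comp (perm (finSuccEquivLast (n := n)).symm)
      (comp (box φ) (perm (splitEquiv A h))) := by
  unfold convToDeltaSummand
  rw [dif_pos h]
  rfl

theorem convToDeltaSummand_of_ne (n : ℕ) (S : FinBij) (A : Set S.carrier) (h : Nat.card ↑Aᶜ ≠ 1) :
    convToDeltaSummand n S A = 0 := dif_neg h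

/-- The map `CatLie(-, n) ⊙ I → CatLie(-, n + 1)`. -/
def convToDeltaMap (X : CatLie) (S : FinBij) :
    ConvSpace (catLieFunctor.obj X) unitI S →ₗ[ℚ] LieHoms S.carrier (Fin (X.n + 1)) :=
  convDesc (M := catLieFunctor.obj X) (N := unitI) (convToDeltaSummand X.n S)

theorem convToDeltaMap_convι (X : CatLie) (S : FinBij) (A : Set S.carrier)
    (φ : LieHoms A (Fin X.n)) (r : unitSpace (S.sub Aᶜ)) :
    convToDeltaMap X S (convι (catLieFunctor.obj X) unitI S A (φ ⊗ₜ r)) =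
      convToDeltaSummand X.n S A (φ ⊗ₜ r) :=
  convDesc_convι (M := catLieFunctor.obj X) (N := unitI) _ _ _

theorem splitEquiv_natural {S T : FinBij} (e : S ⟶ T) (A : Set T.carrier) (h : Nat.card ↑Aᶜ = 1)
    (h' : Nat.card ↑(FinBij.toEquiv e ⁻¹' A)ᶜ = 1) :
    (splitEquiv (FinBij.toEquiv e ⁻¹' A) h').trans
      (Equiv.optionCongr (FinBij.toEquiv (FinBij.restrict e A))) =
    (FinBij.toEquiv e).trans (splitEquiv A h) := by
  rw [← splitEquiv_unique A h ((FinBij.toEquiv e).symm.trans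
    ((splitEquiv (FinBij.toEquiv e ⁻¹' A) h').trans
      (Equiv.optionCongr (FinBij.toEquiv (FinBij.restrict e A)))))]
  · rw [← Equiv.trans_assoc, Equiv.self_trans_symm, Equiv.refl_trans]
    rfl
  · intro x
    have hx : (FinBij.toEquiv e).symm x ∈ FinBij.toEquiv e ⁻¹' A := by
      rw [Set.mem_preimage, Equiv.apply_symm_apply]
      exact x.2
    have := (exists_splitEquiv (FinBij.toEquiv e ⁻¹' A) h').choose_spec ⟨_, hx⟩
    simp only [Equiv.trans_apply]
    refine (congrArg _ this).trans (congrArg some (Subtype.ext ?_))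
    exact (FinBij.toEquiv e).apply_symm_apply x

theorem box_natural_right {S A A' T T' S' : Type} (φ : LieHoms A T) (ε : A' ≃ A)
    (σ : S ≃ Option A) (σ' : S' ≃ Option A') (e : S' ≃ S) (c : LieHoms (Option T) T')
    (h : σ'.trans (Equiv.optionCongr ε) = e.trans σ) :
    comp c (comp (box (comp φ (perm ε))) (perm σ')) =
      comp (comp c (comp (box φ) (perm σ))) (perm e) := by
  rw [box_comp, box_perm, comp_assoc, comp_assoc, comp_assoc, comp_perm_perm, comp_perm_perm, h]

theorem box_natural_left {S A : Type} {m n : ℕ} (ψ : LieHoms (Fin m) (Fin n))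
    (φ : LieHoms A (Fin m)) (σ : LieHoms S (Option A)) :
    comp (perm finSuccEquivLast.symm) (comp (box (comp ψ φ)) σ) =
      comp (comp (perm finSuccEquivLast.symm) (comp (box ψ) (perm finSuccEquivLast)))
        (comp (perm finSuccEquivLast.symm) (comp (box φ) σ)) := by
  rw [box_comp]
  simp only [comp_assoc]
  rw [← comp_assoc (perm finSuccEquivLast) (perm finSuccEquivLast.symm), comp_perm_perm,
    Equiv.symm_trans_self, perm_refl_comp]

theorem convToDeltaMap_convPull (X : CatLie) {S T : FinBij} (e : S ⟶ T) :
    convToDeltaMap X S ∘ₗ convPull (catLieFunctor.obj X) unitI e =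
      comp.flip (perm (FinBij.toEquiv e)) ∘ₗ convToDeltaMap X T := by
  refine conv_ext fun A φ r => ?_
  rw [LinearMap.comp_apply, LinearMap.comp_apply, convPull_convι]
  refine (convToDeltaMap_convι ..).trans (Eq.trans ?_ (congrArg _ (convToDeltaMap_convι ..)).symm)
  have hcard : Nat.card ↑(FinBij.toEquiv e ⁻¹' A)ᶜ = Nat.card ↑Aᶜ :=
    Nat.card_congr (FinBij.toEquiv (FinBij.restrict e Aᶜ))
  by_cases h : Nat.card ↑Aᶜ = 1
  · refine (convToDeltaSummand_tmul _ _ _ (hcard.trans h) _ _).trans ?_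
    refine Eq.trans ?_ (congrArg _ (convToDeltaSummand_tmul _ _ _ h _ _)).symm
    rw [map_smul]
    refine congrArg _ ?_
    exact box_natural_right (A := A) (T := Fin X.n) φ _ _ _ _ _
      (splitEquiv_natural e A h (hcard.trans h))
  · rw [convToDeltaSummand_of_ne _ _ _ h, convToDeltaSummand_of_ne _ _ _ (hcard.trans_ne h),
      LinearMap.zero_apply, LinearMap.zero_apply, map_zero]

theorem convToDeltaMap_convPush {X Y : CatLie} (ψ : X ⟶ Y) (S : FinBij) :
    convToDeltaMap Y S ∘ₗ convPush (catLieFunctor.map ψ) unitI S =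
      comp (S := S.carrier) (T := Fin (X.n + 1)) (U := Fin (Y.n + 1)) (boxOne.map ψ) ∘ₗ
        convToDeltaMap X S := by
  refine conv_ext fun A φ r => ?_
  rw [LinearMap.comp_apply, LinearMap.comp_apply, convPush_convι]
  refine (convToDeltaMap_convι ..).trans (Eq.trans ?_ (congrArg _ (convToDeltaMap_convι ..)).symm)
  by_cases h : Nat.card ↑Aᶜ = 1
  · refine (convToDeltaSummand_tmul _ _ _ h _ _).trans ?_
    refine Eq.trans ?_ (congrArg _ (convToDeltaSummand_tmul _ _ _ h _ _)).symm
    rw [map_smul]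
    refine congrArg _ ?_
    exact box_natural_left (A := A) (m := X.n) (n := Y.n) ψ φ _
  · rw [convToDeltaSummand_of_ne _ _ _ h, convToDeltaSummand_of_ne _ _ _ h,
      LinearMap.zero_apply, LinearMap.zero_apply, map_zero]

/-- The inclusion `CatLie ⊙ I ⟶ δ CatLie`, which identifies `CatLie ⊙ I` with `δ⁽¹⁾ CatLie`. -/
def convToDelta : convBimod catLie unitI ⟶ delta catLie :=
  ObjectProperty.homMk
    { app X :=
        { app S := ModuleCat.ofHom (convToDeltaMap X S.unop)
          naturality _ _ e := ModuleCat.hom_ext (convToDeltaMap_convPull X e.unop) }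
      naturality _ _ ψ := NatTrans.ext (funext fun S =>
        ModuleCat.hom_ext (convToDeltaMap_convPush ψ S.unop)) }

open Classical in
/-- The component of an element of `CatLie(S, T)` in the summand indexed by `f`. -/
def component {S T : Type} (f : {f : S → T // Function.Surjective f}) :
    LieHoms S T →ₗ[ℚ] Summand f.1 :=
  DirectSum.component ℚ _ (fun f : {f : S → T // Function.Surjective f} => Summand f.1) f

/-- The space `δ⁽¹⁾CatLie(S, n) ⊆ δCatLie(S, n) = CatLie(S, n + 1)`: the sum of the summands indexed
by the surjections `f` for which the fibre of the last element has exactly one element. -/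
def deltaOneSpace (S : Type) (n : ℕ) : Submodule ℚ (LieHoms S (Fin (n + 1))) :=
  ⨅ f : {f : {f : S → Fin (n + 1) // Function.Surjective f} //
    Nat.card ↑(f.1 ⁻¹' {Fin.last n}) ≠ 1}, LinearMap.ker (component f.1)

/-! ### The complex and its homology -/

/-- The differential `CatLie ⊙ I ⟶ CatLie`: the restriction of `μ̃` to
`CatLie ⊙ I ≅ δ⁽¹⁾CatLie ⊆ δCatLie`. -/
def differential : convBimod catLie unitI ⟶ catLie := convToDelta ≫ muTilde catLie

open scoped ZeroObject in
/-- The bimodules underlying the complex: `CatLie ⊙ I` in degree one and `CatLie` in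
degree zero. -/
def complexX : ℕ → Bimod
  | 0 => catLie
  | 1 => convBimod catLie unitI
  | _ + 2 => 0

/-- The differentials of the complex. -/
def complexD : ∀ n : ℕ, complexX (n + 1) ⟶ complexX n
  | 0 => differential
  | _ + 1 => 0

/-- The complex of bimodules `CatLie ⊙ I ⟶ CatLie`, concentrated in homological degrees one
and zero, which underlies `ℂLie`. -/
def complexLie : ChainComplex Bimod ℕ :=
  ChainComplex.of complexX complexD fun _ => zero_comp

theorem complexLie_d_two_one : complexLie.d 2 1 = 0 :=
  ChainComplex.of_d complexX complexD 1

/-- The homology bimodule `H₀`. -/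
def hZero : Bimod := complexLie.homology 0

/-- The homology bimodule `H₁`. -/
def hOne : Bimod := complexLie.homology 1
/-- The inclusion of `H₁` in the term of degree one: as the term of degree two is zero, `H₁` is
the object of cycles. -/
def hOneι : hOne ⟶ convBimod catLie unitI :=
  (complexLie.isoHomologyπ 2 1 (by simp) complexLie_d_two_one).inv ≫ complexLie.iCycles 1

/-- The projection of the term of degree zero onto `H₀`, which is its quotient by the
boundaries. -/
def hZeroπ : catLie ⟶ hZero :=
  complexLie.pOpcycles 0 ≫ complexLie.isoHomologyι₀.inv

/-! ### Syzygies in an abelian category -/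

/-- The sequence `0 → Z → P₁ → P₀ → M → 0` is exact, with `P₀` and `P₁` projective; it exhibits
`Z` as a second syzygy of `M`. -/
structure ExhibitsSecondSyzygy {C : Type*} [Category* C] [Abelian C] {Z P₁ P₀ M : C}
    (j : Z ⟶ P₁) (d : P₁ ⟶ P₀) (q : P₀ ⟶ M) : Prop where
  projective_zero : Projective P₀
  projective_one : Projective P₁
  mono : Mono j
  comp_one : j ≫ d = 0
  exact_one : (ShortComplex.mk j d comp_one).Exact
  comp_zero : d ≫ q = 0
  exact_zero : (ShortComplex.mk d q comp_zero).Exact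
  epi : Epi q

/-- The sequence `P₁ → P₀ → M` is the beginning `R₁ → R₀ → M` of a projective resolution of
`M`. -/
def BeginsProjectiveResolution {C : Type*} [Category* C] [Abelian C] {P₁ P₀ M : C}
    (d : P₁ ⟶ P₀) (q : P₀ ⟶ M) : Prop :=
  ∃ (R : ProjectiveResolution M) (e₀ : R.complex.X 0 ≅ P₀) (e₁ : R.complex.X 1 ≅ P₁),
    R.complex.d 1 0 ≫ e₀.hom = e₁.hom ≫ d ∧
    e₀.hom ≫ q = R.π.f 0 ≫ (HomologicalComplex.singleObjXSelf (ComplexShape.down ℕ) 0 M).hom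

end CatLieSyzygy

end

/-! The theorem splits into three points that hardly interact.

The isomorphism onto $\delta^{(1)}\mathsf{CatLie}$. The map $\varphi\mapsto\varphi\boxplus 1$ has an
explicit retraction `unbox`. In a summand whose surjection is $g\amalg 1$, the tensor factor at the
new point lies in $\mathfrak{Lie}$ of a single letter, which is a line, so that factor may be
replaced by its coefficient. The other factors do not contain the new letter, so nothing is lost by
killing it. On all remaining summands `unbox` is zero. Two decompositions $S=A\amalg\{s\}$ with
different $s$ lead to surjections with different last fibres, so the retractions for the various $A$
do not see each other's images, and their sum is a left inverse (`convToDeltaMap_injective`).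
Conversely, in a summand with one-point last fibre one takes for $A$ the complement of that fibre;
`box_unbox_elem` then produces a preimage (`range_convToDeltaMap`).

Projectivity. Epimorphisms of bimodules are pointwise surjective (`Bimod.surjective_of_epi`). By a
Maschke argument over $\mathbb{Q}$, it suffices to lift maps on the values at each set
$\{1,\dots,k\}$, compatibly with the left action of $\mathsf{CatLie}$ only: averaging over the $k!$
bijections restores equivariance (`Bimod.projective_of_lifts`). At $\{1,\dots,k\}$ the bimodule
$\mathsf{CatLie}$ is the representable functor $\mathsf{CatLie}(k,-)$, so the Yoneda lemma provides
lifts. The bimodule $\mathsf{CatLie}\odot I$ is there a direct sum of functors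
$\mathsf{CatLie}(A,-)$, one for each $A$ with one-point complement, and each is again representable.
Neither the differential nor $\mu$ plays a role here.

Resolution and syzygy. The same criterion shows that $\bigoplus_m\mathsf{CatLie}(m,-)\otimes M_m$ is
projective for every family of right modules $M_m$. Every bimodule is a quotient of one of these, so
there are enough projectives, and the presentation $\mathsf{CatLie}\odot
I\to\mathsf{CatLie}\to\mathbf{H}_0$ can be continued by repeatedly covering kernels
(`beginsProjectiveResolution_of_exact`). The four-term exact sequence is formal: in a complex with
only two terms, $\mathbf{H}_1$ is the kernel of the differential and $\mathbf{H}_0$ its cokernel. -/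

noncomputable section

namespace CatLieSyzygy

/-! ### Extending an exact sequence to a projective resolution -/

section Resolution

variable {C : Type*} [Category* C] [Abelian C]

/-- The complex `⋯ → P₁ → P₀` obtained from `d : P₁ ⟶ P₀` by iterated projective covers of
kernels. -/
def extendComplex [EnoughProjectives C] {P₁ P₀ : C} (d : P₁ ⟶ P₀) : ChainComplex C ℕ :=
  ChainComplex.mk' P₀ P₁ d fun f =>
    ⟨Projective.syzygies f, Projective.d f, (Category.assoc _ _ _).trans
      ((congrArg _ (kernel.condition f)).trans comp_zero)⟩

theorem extendComplex_d [EnoughProjectives C] {P₁ P₀ : C} (d : P₁ ⟶ P₀) :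
    (extendComplex d).d 1 0 = d :=
  ChainComplex.mk'_d_1_0 ..

/-- The terms of degree at least two of the extended complex are projective covers of kernels. -/
def extendComplexXIso [EnoughProjectives C] {P₁ P₀ : C} (d : P₁ ⟶ P₀) (n : ℕ) :
    (extendComplex d).X (n + 2) ≅ Projective.syzygies ((extendComplex d).d (n + 1) n) :=
  ChainComplex.mk'XIso ..

theorem extendComplex_d_succ [EnoughProjectives C] {P₁ P₀ : C} (d : P₁ ⟶ P₀) (n : ℕ) :
    (extendComplex d).d (n + 2) (n + 1) =
      (extendComplexXIso d n).hom ≫ Projective.d ((extendComplex d).d (n + 1) n) :=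
  ChainComplex.mk'_d ..

/-- Each new term is chosen to surject onto the kernel of the preceding differential, so exactness
in positive degrees holds by construction, whatever `d` is. -/
theorem extendComplex_exactAt_succ [EnoughProjectives C] {P₁ P₀ : C} (d : P₁ ⟶ P₀) (n : ℕ) :
    (extendComplex d).ExactAt (n + 1) := by
  rw [HomologicalComplex.exactAt_iff' _ (n + 1 + 1) (n + 1) n (by simp) (by simp)]
  refine ShortComplex.exact_of_iso ?_ (exact_d_f ((extendComplex d).d (n + 1) n))
  refine ShortComplex.isoMk (extendComplexXIso d n).symm (Iso.refl _) (Iso.refl _) ?_ ?_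
  · exact ((Iso.inv_comp_eq _).2 (extendComplex_d_succ d n)).trans (Category.comp_id _).symm
  · exact (Category.id_comp _).trans (Category.comp_id _).symm

theorem projective_extendComplex_X [EnoughProjectives C] {P₁ P₀ : C} [Projective P₁]
    [Projective P₀] (d : P₁ ⟶ P₀) : ∀ n, Projective ((extendComplex d).X n)
  | 0 => ‹Projective P₀›
  | 1 => ‹Projective P₁›
  | n + 2 => Projective.of_iso (extendComplexXIso d n).symm (Projective.projective_over _)

/-- If there are enough projectives, a presentation by projectives begins a projective
resolution. -/
theorem beginsProjectiveResolution_of_exact [EnoughProjectives C] {P₁ P₀ M : C} [Projective P₁]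
    [Projective P₀] (d : P₁ ⟶ P₀) (q : P₀ ⟶ M) [Epi q] (w : d ≫ q = 0)
    (h : (ShortComplex.mk d q w).Exact) : BeginsProjectiveResolution d q := by
  let π : extendComplex d ⟶ (ChainComplex.single₀ C).obj M :=
    (ChainComplex.toSingle₀Equiv _ _).symm ⟨q, by rw [extendComplex_d]; exact w⟩
  have hπ : π.f 0 = q := ChainComplex.toSingle₀Equiv_symm_apply_f_zero ..
  refine ⟨{ complex := extendComplex d, projective := projective_extendComplex_X d, π := π,
            quasiIso := ⟨fun n => ?_⟩ }, Iso.refl _, Iso.refl _, ?_, ?_⟩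
  · cases n with
    | zero =>
      -- In degree zero, a quasi-isomorphism onto a single object means that `P₁ → P₀ → M` is exact
      -- and that `q` is epi.
      rw [ChainComplex.quasiIsoAt₀_iff, ShortComplex.quasiIso_iff_of_zeros']
      · refine (ShortComplex.exact_and_epi_g_iff_of_iso ?_).2 ⟨h, ‹Epi q›⟩
        refine ShortComplex.isoMk (Iso.refl _) (Iso.refl _) (Iso.refl _) ?_ ?_
        · exact (Category.id_comp _).trans
            ((extendComplex_d d).symm.trans (Category.comp_id _).symm)
        · exact (Category.id_comp _).trans (hπ.symm.trans (Category.comp_id _).symm)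
      all_goals rfl
    | succ n =>
      rw [quasiIsoAt_iff_exactAt']
      · exact extendComplex_exactAt_succ d n
      · exact ChainComplex.exactAt_succ_single_obj _ _
  · exact (Category.comp_id _).trans ((extendComplex_d d).trans (Category.id_comp _).symm)
  · exact (Category.id_comp q).trans (hπ.symm.trans (Category.comp_id _).symm)

/-! ### The homology of a complex which vanishes in degree two -/

theorem mono_isoHomologyπ_inv_iCycles (K : ChainComplex C ℕ) (h : K.d 2 1 = 0) :
    Mono ((K.isoHomologyπ 2 1 (by simp) h).inv ≫ K.iCycles 1) :=
  inferInstance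

theorem isoHomologyπ_inv_iCycles_comp (K : ChainComplex C ℕ) (h : K.d 2 1 = 0)
    {d : K.X 1 ⟶ K.X 0} (hd : K.d 1 0 = d) :
    ((K.isoHomologyπ 2 1 (by simp) h).inv ≫ K.iCycles 1) ≫ d = 0 := by
  subst hd
  simp

/-- With no boundaries in degree one, homology is the object of cycles, which is a kernel of the
differential. The equation `hd` makes this applicable to a morphism that is only provably equal to
`K.d 1 0`. -/
theorem exact_isoHomologyπ_inv_iCycles (K : ChainComplex C ℕ) (h : K.d 2 1 = 0)
    {d : K.X 1 ⟶ K.X 0} (hd : K.d 1 0 = d) :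
    (ShortComplex.mk _ _ (isoHomologyπ_inv_iCycles_comp K h hd)).Exact := by
  subst hd
  exact ShortComplex.exact_of_f_is_kernel _ (IsKernel.isoKernel _ _
    (K.cyclesIsKernel 1 0 (by simp)) (K.isoHomologyπ 2 1 (by simp) h).symm rfl)

theorem epi_pOpcycles_isoHomologyι_inv (K : ChainComplex C ℕ) :
    Epi (K.pOpcycles 0 ≫ K.isoHomologyι₀.inv) :=
  inferInstance

theorem comp_pOpcycles_isoHomologyι_inv (K : ChainComplex C ℕ) {d : K.X 1 ⟶ K.X 0}
    (hd : K.d 1 0 = d) : d ≫ K.pOpcycles 0 ≫ K.isoHomologyι₀.inv = 0 := by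
  subst hd
  simp

/-- Dually, nothing leaves degree zero, so homology there is the object of opcycles, a cokernel of
the differential. -/
theorem exact_pOpcycles_isoHomologyι_inv (K : ChainComplex C ℕ) {d : K.X 1 ⟶ K.X 0}
    (hd : K.d 1 0 = d) : (ShortComplex.mk _ _ (comp_pOpcycles_isoHomologyι_inv K hd)).Exact := by
  subst hd
  exact ShortComplex.exact_of_g_is_cokernel _ (IsCokernel.cokernelIso _ _
    (K.opcyclesIsCokernel 1 0 (by simp)) K.isoHomologyι₀.symm rfl)

end Resolution

/-! ### Exactness of the four-term sequence -/

theorem complexLie_d_one_zero : complexLie.d 1 0 = differential :=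
  ChainComplex.of_d complexX complexD 0

theorem differential_comp_hZeroπ : differential ≫ hZeroπ = 0 :=
  comp_pOpcycles_isoHomologyι_inv complexLie complexLie_d_one_zero

theorem exact_differential_hZeroπ :
    (ShortComplex.mk differential hZeroπ differential_comp_hZeroπ).Exact :=
  exact_pOpcycles_isoHomologyι_inv complexLie complexLie_d_one_zero

theorem epi_hZeroπ : Epi hZeroπ :=
  epi_pOpcycles_isoHomologyι_inv complexLie

/-- Apart from the two projectivity statements, this is formal homological algebra of a two-term
complex. -/
theorem exhibitsSecondSyzygy_hOneι (h₀ : Projective catLie)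
    (h₁ : Projective (convBimod catLie unitI)) :
    ExhibitsSecondSyzygy hOneι differential hZeroπ where
  projective_zero := h₀
  projective_one := h₁
  mono := mono_isoHomologyπ_inv_iCycles complexLie complexLie_d_two_one
  comp_one := isoHomologyπ_inv_iCycles_comp complexLie complexLie_d_two_one complexLie_d_one_zero
  exact_one := exact_isoHomologyπ_inv_iCycles complexLie complexLie_d_two_one complexLie_d_one_zero
  comp_zero := differential_comp_hZeroπ
  exact_zero := exact_differential_hZeroπ
  epi := epi_hZeroπ

/-! ### A left inverse of `- ⊞ 1` -/

/-- A bracket uses two disjoint nonempty sets of letters, hence at least two letters. Nonemptiness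
is part of the statement so that the induction can use it for both entries of a bracket. -/
theorem IsLieMonomial.eq_of_singleton {S : Type} {A : Set S} {x : FreeLieAlgebra ℚ S}
    (h : IsLieMonomial A x) : A.Nonempty ∧ ∀ s, A = {s} → x = FreeLieAlgebra.of ℚ s := by
  induction h with
  | of s => exact ⟨⟨s, rfl⟩, fun t ht => by rw [Set.singleton_eq_singleton_iff.1 ht]⟩
  | @bracket A B x y hAB _ _ hA hB =>
    refine ⟨hA.1.inl, fun s hs => ?_⟩
    obtain ⟨a, ha⟩ := hA.1
    obtain ⟨b, hb⟩ := hB.1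
    have ha' : a = s := (hs ▸ Set.mem_union_left B ha : a ∈ ({s} : Set S))
    have hb' : b = s := (hs ▸ Set.mem_union_right A hb : b ∈ ({s} : Set S))
    exact absurd (ha'.trans hb'.symm ▸ ha) (Set.disjoint_right.1 hAB hb)

/-- The sum of the coefficients of the letters in a Lie element. -/
def letterCoeff {S : Type} : FreeLieAlgebra ℚ S →ₗ[ℚ] ℚ :=
  -- With the commutator bracket `ℚ` is an abelian Lie algebra, so the induced map vanishes on
  -- brackets and sends every letter to 1.
  letI : LieRing ℚ := LieRing.ofAssociativeRing
  letI : LieAlgebra ℚ ℚ := LieAlgebra.ofAssociativeAlgebra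
  (FreeLieAlgebra.lift ℚ fun _ => 1 : FreeLieAlgebra ℚ S →ₗ⁅ℚ⁆ ℚ).toLinearMap

theorem letterCoeff_of {S : Type} (s : S) : letterCoeff (FreeLieAlgebra.of ℚ s) = 1 :=
  letI : LieRing ℚ := LieRing.ofAssociativeRing
  letI : LieAlgebra ℚ ℚ := LieAlgebra.ofAssociativeAlgebra
  FreeLieAlgebra.lift_of_apply (R := ℚ) (L := ℚ) (fun _ : S => 1) s

/-- The space `𝔏𝔦𝔢({s})` is spanned by the letter `s`. -/
theorem eq_smul_of_mem_lieOn_singleton {S : Type} {A : Set S} {s : S} (hA : A = {s})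
    {x : FreeLieAlgebra ℚ S} (hx : x ∈ lieOn A) :
    x = letterCoeff x • FreeLieAlgebra.of ℚ s := by
  induction hx using Submodule.span_induction with
  | mem x hx => rw [IsLieMonomial.eq_of_singleton hx |>.2 s hA, letterCoeff_of, one_smul]
  | zero => rw [map_zero, zero_smul]
  | add x y _ _ h₁ h₂ => rw [map_add, add_smul, ← h₁, ← h₂]
  | smul r x _ h => rw [map_smul, smul_assoc, ← h]

/-- The map of free Lie algebras which kills the additional letter. -/
def unlabel {S : Type} : FreeLieAlgebra ℚ (Option S) →ₗ⁅ℚ⁆ FreeLieAlgebra ℚ S :=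
  FreeLieAlgebra.lift ℚ fun o => o.elim 0 (FreeLieAlgebra.of ℚ)

/-- No condition on `C` is needed: a monomial containing the letter `none` goes to zero, which is
multilinear in any set of letters. -/
theorem unlabel_mem {S : Type} {C : Set (Option S)} {x : FreeLieAlgebra ℚ (Option S)}
    (hx : x ∈ lieOn C) : unlabel x ∈ lieOn (some ⁻¹' C) := by
  induction hx using Submodule.span_induction with
  | mem x hx =>
    induction hx with
    | of o =>
      unfold unlabel
      rw [FreeLieAlgebra.lift_of_apply]
      cases o with
      | none => exact zero_mem _
      | some s => exact of_mem_lieOn s (by ext; simp)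
    | bracket hAB _ _ h₁ h₂ =>
      rw [LieHom.map_lie, Set.preimage_union]
      exact lie_mem_lieOn (hAB.preimage some) h₁ h₂
  | zero => rw [map_zero]; exact zero_mem _
  | add x y _ _ h₁ h₂ => rw [map_add]; exact add_mem h₁ h₂
  | smul r x _ h => rw [map_smul]; exact Submodule.smul_mem _ _ h

theorem lift_of_eq_self {S : Type} (x : FreeLieAlgebra ℚ S) :
    FreeLieAlgebra.lift ℚ (FreeLieAlgebra.of ℚ) x = x := by
  have : FreeLieAlgebra.lift ℚ (FreeLieAlgebra.of ℚ (X := S)) = LieHom.id :=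
    FreeLieAlgebra.hom_ext fun x => FreeLieAlgebra.lift_of_apply ..
  exact LieHom.congr_fun this x

theorem unlabel_relabel {S : Type} (x : FreeLieAlgebra ℚ S) : unlabel (relabel some x) = x :=
  (lift_relabel ..).trans (lift_of_eq_self x)

/-- A substitution depends only on the letters of `C`, and away from `none` the composite
substitution fixes every letter. -/
theorem relabel_unlabel {S : Type} {C : Set (Option S)} (hC : none ∉ C)
    {x : FreeLieAlgebra ℚ (Option S)} (hx : x ∈ lieOn C) : relabel some (unlabel x) = x := by
  refine (relabel_lift ..).trans (Eq.trans (subst_congr (fun o ho => ?_) hx) (lift_of_eq_self x))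
  cases o with
  | none => exact absurd ho hC
  | some s => exact relabel_of ..

/-- The relation to `g` is a hypothesis on an arbitrary `f`, because the index of a summand is only
propositionally of the form `Option.map g`; this avoids transporting tensors along the equality. -/
theorem unlabel_mem_of_eq {S T : Type} {f : Option S → Option T} {g : S → T}
    (h : f = Option.map g) {t : T} {x : FreeLieAlgebra ℚ (Option S)}
    (hx : x ∈ lieOn (f ⁻¹' {some t})) : unlabel x ∈ lieOn (g ⁻¹' {t}) := by
  subst h
  have : some ⁻¹' (Option.map g ⁻¹' {some t}) = g ⁻¹' {t} := by ext; simp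
  exact this ▸ unlabel_mem hx

/-- The inverse on tensors of `- ⊞ 1`: the factor at the additional point is replaced by its
coefficient. -/
def unboxTensor {S T : Type} (f : Option S → Option T) (g : S → T) (h : f = Option.map g) :
    MultilinearMap ℚ (fun o : Option T => lieOn (f ⁻¹' {o})) (Summand g) where
  toFun a := letterCoeff (a none : FreeLieAlgebra ℚ (Option S)) •
    pureTensor g fun t => ⟨unlabel (a (some t) : FreeLieAlgebra ℚ (Option S)),
      unlabel_mem_of_eq h (a (some t)).2⟩
  map_update_add' := by
    classical
    intro _ a o x y
    -- The slot `none` affects only the scalar in front, a slot `some t` only one factor of the pure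
    -- tensor.
    rcases o with _ | t
    · simp only [Function.update_self, Function.update_of_ne (Option.some_ne_none _),
        Submodule.coe_add, map_add, add_smul]
    · have key : ∀ z : lieOn (f ⁻¹' {some t}),
          (fun t' => (⟨unlabel (Function.update a (some t) z (some t') :
            FreeLieAlgebra ℚ (Option S)), unlabel_mem_of_eq h
              (Function.update a (some t) z (some t')).2⟩ : lieOn (g ⁻¹' {t'}))) =
          Function.update (fun t' => ⟨unlabel (a (some t') : FreeLieAlgebra ℚ (Option S)),
            unlabel_mem_of_eq h (a (some t')).2⟩) t ⟨unlabel z, unlabel_mem_of_eq h z.2⟩ := by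
        intro z
        funext t'
        rcases eq_or_ne t' t with rfl | h'
        · simp only [Function.update_self]
        · rw [Function.update_of_ne h']
          simp only [Function.update_of_ne (Option.some_injective _ |>.ne h')]
      rw [key, key, key]
      simp only [Function.update_of_ne (Option.some_ne_none t).symm]
      rw [← smul_add, ← MultilinearMap.map_update_add]
      congr 3
      exact Subtype.ext (map_add _ _ _)
  map_update_smul' := by
    classical
    intro _ a o r x
    rcases o with _ | t
    · simp only [Function.update_self, Function.update_of_ne (Option.some_ne_none _),
        Submodule.coe_smul, map_smul, smul_assoc]
    · have key : ∀ z : lieOn (f ⁻¹' {some t}),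
          (fun t' => (⟨unlabel (Function.update a (some t) z (some t') :
            FreeLieAlgebra ℚ (Option S)), unlabel_mem_of_eq h
              (Function.update a (some t) z (some t')).2⟩ : lieOn (g ⁻¹' {t'}))) =
          Function.update (fun t' => ⟨unlabel (a (some t') : FreeLieAlgebra ℚ (Option S)),
            unlabel_mem_of_eq h (a (some t')).2⟩) t ⟨unlabel z, unlabel_mem_of_eq h z.2⟩ := by
        intro z
        funext t'
        rcases eq_or_ne t' t with rfl | h'
        · simp only [Function.update_self]
        · rw [Function.update_of_ne h']
          simp only [Function.update_of_ne (Option.some_injective _ |>.ne h')]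
      rw [key, key]
      simp only [Function.update_of_ne (Option.some_ne_none t).symm]
      rw [smul_comm]
      refine congrArg _ (Eq.trans ?_ (MultilinearMap.map_update_smul _ _ _ _ _))
      congr 2
      exact Subtype.ext (map_smul _ _ _)

theorem surjective_of_eq_optionMap {S T : Type} {f : Option S → Option T} {g : S → T}
    (h : f = Option.map g) (hf : Function.Surjective f) : Function.Surjective g := by
  subst h
  intro t
  obtain ⟨_ | s, hs⟩ := hf (some t)
  · simp at hs
  · exact ⟨s, by simpa using hs⟩

open Classical in
/-- The left inverse of `- ⊞ 1` which vanishes on the summands not in its image. -/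
def unbox {S T : Type} : LieHoms (Option S) (Option T) →ₗ[ℚ] LieHoms S T :=
  summandDesc fun f => if h : ∃ g, f.1 = Option.map g then
    summandι ⟨h.choose, surjective_of_eq_optionMap h.choose_spec f.2⟩ ∘ₗ
      summandLift (unboxTensor f.1 h.choose h.choose_spec)
  else 0

theorem unbox_elem_of_eq {S T : Type} {f : Option S → Option T} {g : S → T}
    (h : f = Option.map g) (hf : Function.Surjective f) (a : Option T → FreeLieAlgebra ℚ (Option S))
    (ha : ∀ o, a o ∈ lieOn (f ⁻¹' {o})) :
    unbox (elem f hf a ha) = letterCoeff (a none) • elem g (surjective_of_eq_optionMap h hf)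
      (fun t => unlabel (a (some t))) (fun t => unlabel_mem_of_eq h (ha (some t))) := by
  have h' : ∃ g, f = Option.map g := ⟨g, h⟩
  -- Since `Option.map` is injective, the map chosen in the definition of `unbox` is the given `g`.
  obtain rfl : h'.choose = g := Option.map_injective' (h'.choose_spec.symm.trans h)
  unfold unbox
  conv_lhs => unfold elem
  rw [summandDesc_summandι, dif_pos h', LinearMap.comp_apply, summandLift_pureTensor]
  exact map_smul _ _ _

theorem unbox_elem_of_ne {S T : Type} {f : Option S → Option T} (h : ∀ g, f ≠ Option.map g)
    (hf : Function.Surjective f) (a : Option T → FreeLieAlgebra ℚ (Option S))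
    (ha : ∀ o, a o ∈ lieOn (f ⁻¹' {o})) : unbox (elem f hf a ha) = 0 := by
  unfold unbox elem
  rw [summandDesc_summandι, dif_neg (fun ⟨g, hg⟩ => h g hg), LinearMap.zero_apply]

theorem unbox_box {S T : Type} (φ : LieHoms S T) : unbox (box φ) = φ := by
  induction φ using lieHoms_induction with
  | hzero => simp only [map_zero]
  | hadd χ χ' h h' => simp only [map_add, h, h']
  | hsmul r χ h => simp only [map_smul, h]
  | helem f hf a ha =>
  rw [box_elem, unbox_elem_of_eq rfl]
  refine (congrArg₂ _ (letterCoeff_of none) ?_).trans (one_smul ℚ _)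
  exact elem_congr rfl (funext fun t => unlabel_relabel (a t)) _ _ _ _

/-- If `e` moves the additional point, then `Option.map f ∘ e` does not send `none` to `none`, so
every summand involved is one on which `unbox` is zero. This separates the decompositions of a set
with different omitted points. -/
theorem unbox_comp_box_perm {R S T : Type} (φ : LieHoms S T) (e : Option R ≃ Option S)
    (he : e none ≠ none) : unbox (comp (box φ) (perm e)) = 0 := by
  induction φ using lieHoms_induction with
  | hzero => simp only [map_zero, LinearMap.zero_apply]
  | hadd χ χ' h h' => simp only [map_add, LinearMap.add_apply, h, h', add_zero]
  | hsmul r χ h => simp only [map_smul, LinearMap.smul_apply, h, smul_zero]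
  | helem f hf a ha =>
  unfold perm
  rw [box_elem, comp_elem]
  refine unbox_elem_of_ne (fun g hg => he ?_) _ _ _
  exact Option.map_eq_none_iff.1 (congrFun hg none)

/-- The fibre over `none` is the single point `none`, so that factor is a multiple of the letter;
the other fibres avoid the letter, so killing it and adding it back changes nothing there. -/
theorem box_unbox_elem {S T : Type} {f : Option S → Option T} {g : S → T}
    (h : f = Option.map g) (hf : Function.Surjective f) (a : Option T → FreeLieAlgebra ℚ (Option S))
    (ha : ∀ o, a o ∈ lieOn (f ⁻¹' {o})) : box (unbox (elem f hf a ha)) = elem f hf a ha := by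
  classical
  rw [unbox_elem_of_eq h, map_smul, box_elem]
  subst h
  unfold elem
  rw [← map_smul]
  congr 1
  -- The coefficient taken out by `unbox` is moved back into the slot `none`; multilinearity then
  -- compares the two tensors.
  have key : (fun o => (⟨a o, ha o⟩ : lieOn (Option.map g ⁻¹' {o}))) = Function.update
      (fun o => ⟨boxFamily (fun t => unlabel (a (some t))) o, boxFamily_mem g _
        (fun t => unlabel_mem_of_eq rfl (ha (some t))) o⟩) none
      (letterCoeff (a none) • ⟨FreeLieAlgebra.of ℚ none,
        of_mem_lieOn _ (preimage_optionMap_none g)⟩) := by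
    funext o
    refine Subtype.ext ?_
    cases o with
    | none =>
      rw [Function.update_self]
      exact eq_smul_of_mem_lieOn_singleton (preimage_optionMap_none g) (ha none)
    | some t =>
      rw [Function.update_of_ne (Option.some_ne_none t)]
      exact (relabel_unlabel (by simp) (ha (some t))).symm
  rw [key, MultilinearMap.map_update_smul]
  congr 2
  -- The boxed family already has the letter `none` in the slot `none`, so the remaining update is
  -- trivial.
  exact (Function.update_eq_self none _).symm

/-! ### The image of `CatLie ⊙ I` in `δ CatLie` -/

/-- The bijection is specified only on `A`; since all values `some y` are taken there, injectivity
leaves `none` for the omitted point. -/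
theorem splitEquiv_eq_none_iff {S : Type} (A : Set S) (h : Nat.card ↑Aᶜ = 1) (x : S) :
    splitEquiv A h x = none ↔ x ∉ A := by
  have h' := (exists_splitEquiv A h).choose_spec
  refine ⟨fun hx hxA => ?_, fun hx => ?_⟩
  · exact Option.some_ne_none _ ((h' ⟨x, hxA⟩).symm.trans hx)
  · by_contra hne
    obtain ⟨y, hy⟩ := Option.ne_none_iff_exists'.1 hne
    exact hx ((splitEquiv A h).injective (hy.trans (h' y).symm) ▸ y.2)

theorem splitEquiv_symm_none_notMem {S : Type} (A : Set S) (h : Nat.card ↑Aᶜ = 1) :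
    (splitEquiv A h).symm none ∉ A :=
  (splitEquiv_eq_none_iff A h _).1 (Equiv.apply_symm_apply _ _)

theorem eq_of_notMem_of_notMem {S : Type} {A B : Set S} (hA : Nat.card ↑Aᶜ = 1)
    (hB : Nat.card ↑Bᶜ = 1) {x : S} (hxA : x ∉ A) (hxB : x ∉ B) : A = B := by
  obtain ⟨a, ha⟩ := Set.ncard_eq_one.1 (show Aᶜ.ncard = 1 from hA)
  obtain ⟨b, hb⟩ := Set.ncard_eq_one.1 (show Bᶜ.ncard = 1 from hB)
  have hxa : x = a := (ha ▸ hxA : x ∈ ({a} : Set S))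
  have hxb : x = b := (hb ▸ hxB : x ∈ ({b} : Set S))
  rw [← compl_inj_iff, ha, hb, ← hxa, ← hxb]

theorem unitSpace_of_card {S : FinBij} (h : Nat.card S.carrier = 1) : unitSpace S = ⊤ := if_pos h

theorem unitSpace_of_card_ne {S : FinBij} (h : Nat.card S.carrier ≠ 1) : unitSpace S = ⊥ := if_neg h

/-- The generator of `I` on a set with one element. -/
def unitGen (S : FinBij) (h : Nat.card S.carrier = 1) : unitSpace S :=
  ⟨1, unitSpace_of_card h ▸ Submodule.mem_top⟩

theorem eq_smul_unitGen (S : FinBij) (h : Nat.card S.carrier = 1) (r : unitSpace S) :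
    r = (r : ℚ) • unitGen S h :=
  Subtype.ext (mul_one (r : ℚ)).symm

theorem eq_zero_of_mem_unitSpace {S : FinBij} (h : Nat.card S.carrier ≠ 1) (r : unitSpace S) :
    r = 0 :=
  Subtype.ext ((Submodule.mem_bot ℚ).1 (unitSpace_of_card_ne h ▸ r.2))

open Classical in
/-- The component indexed by `A` of the left inverse of `CatLie(-, n) ⊙ I → CatLie(-, n + 1)`. -/
def deltaToConvComponent (X : CatLie) (S : FinBij) (A : Set S.carrier) :
    LieHoms S.carrier (Fin (X.n + 1)) →ₗ[ℚ] ConvSpace (catLieFunctor.obj X) unitI S :=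
  if h : Nat.card ↑Aᶜ = 1 then
    convι (catLieFunctor.obj X) unitI S A ∘ₗ
      ((TensorProduct.mk ℚ (LieHoms A (Fin X.n)) (unitSpace (S.sub Aᶜ))).flip
        (unitGen (S.sub Aᶜ) h)) ∘ₗ unbox ∘ₗ comp (perm finSuccEquivLast) ∘ₗ
          comp.flip (perm (splitEquiv A h).symm)
  else 0

theorem deltaToConvComponent_apply (X : CatLie) (S : FinBij) (A : Set S.carrier)
    (h : Nat.card ↑Aᶜ = 1) (φ : LieHoms S.carrier (Fin (X.n + 1))) :
    deltaToConvComponent X S A φ = convι (catLieFunctor.obj X) unitI S A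
      ((unbox (comp (perm finSuccEquivLast) (comp φ (perm (splitEquiv A h).symm))) :
        LieHoms A (Fin X.n)) ⊗ₜ unitGen (S.sub Aᶜ) h) := by
  unfold deltaToConvComponent
  rw [dif_pos h]
  rfl

theorem deltaToConvComponent_of_ne (X : CatLie) (S : FinBij) (A : Set S.carrier)
    (h : Nat.card ↑Aᶜ ≠ 1) : deltaToConvComponent X S A = 0 := dif_neg h

/-- Embedding along one decomposition `σ` and extracting along another `σ'` leaves only the change
of decomposition. It is the identity when the two agree. -/
theorem comp_perm_conjugate {R S T A : Type} {n : ℕ} (ψ : LieHoms A (Option T))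
    (τ : Fin n ≃ Option T) (σ : S ≃ A) (σ' : S ≃ R) :
    comp (perm τ) (comp (comp (perm τ.symm) (comp ψ (perm σ))) (perm σ'.symm)) =
      comp ψ (perm (σ'.symm.trans σ)) := by
  rw [comp_assoc, comp_assoc, ← comp_assoc (perm τ), comp_perm_perm, comp_perm_perm,
    Equiv.symm_trans_self, perm_refl_comp]

/-- The hypothesis `h` joins the two reasons for vanishing: either `A` and `B` differ, or `I` is
zero on the complement of `A`. -/
theorem deltaToConvComponent_convToDeltaMap (X : CatLie) (S : FinBij) (A B : Set S.carrier)
    (φ : LieHoms A (Fin X.n)) (r : unitSpace (S.sub Aᶜ)) (h : B = A → Nat.card ↑Aᶜ ≠ 1) :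
    deltaToConvComponent X S B
      (convToDeltaMap X S (convι (catLieFunctor.obj X) unitI S A (φ ⊗ₜ r))) = 0 := by
  rw [convToDeltaMap_convι]
  by_cases hA : Nat.card ↑Aᶜ = 1
  · by_cases hB : Nat.card ↑Bᶜ = 1
    · rw [convToDeltaSummand_tmul X.n S A hA φ r, map_smul, deltaToConvComponent_apply X S B hB,
        comp_perm_conjugate, unbox_comp_box_perm]
      · refine (congrArg _ ((congrArg _ ?_).trans (map_zero _))).trans (smul_zero _)
        exact TensorProduct.zero_tmul _ _
      -- If the change of decomposition fixed the additional point, the point omitted by `B` would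
      -- also be omitted by `A`, forcing `B = A`.
      intro h'
      refine h (eq_of_notMem_of_notMem hB hA (splitEquiv_symm_none_notMem B hB) ?_) hA
      exact (splitEquiv_eq_none_iff A hA _).1 h'
    · rw [deltaToConvComponent_of_ne X S B hB, LinearMap.zero_apply]
  · rw [convToDeltaSummand_of_ne X.n S A hA, LinearMap.zero_apply, map_zero]

theorem deltaToConvComponent_convToDeltaMap_self (X : CatLie) (S : FinBij) (A : Set S.carrier)
    (φ : LieHoms A (Fin X.n)) (r : unitSpace (S.sub Aᶜ)) :
    deltaToConvComponent X S A
      (convToDeltaMap X S (convι (catLieFunctor.obj X) unitI S A (φ ⊗ₜ r))) =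
        convι (catLieFunctor.obj X) unitI S A (φ ⊗ₜ r) := by
  by_cases hA : Nat.card ↑Aᶜ = 1
  · rw [convToDeltaMap_convι, convToDeltaSummand_tmul X.n S A hA φ r, map_smul,
      deltaToConvComponent_apply X S A hA, comp_perm_conjugate, Equiv.symm_trans_self,
      comp_perm_refl, unbox_box, ← map_smul]
    refine congrArg _ ?_
    exact (TensorProduct.tmul_smul _ _ _).symm.trans
      (congrArg _ (eq_smul_unitGen (S.sub Aᶜ) hA r).symm)
  -- Here `I` vanishes on the complement, so both sides are zero.
  · have hr : φ ⊗ₜ[ℚ] r = 0 := by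
      rw [eq_zero_of_mem_unitSpace hA r, TensorProduct.tmul_zero]
    refine (deltaToConvComponent_convToDeltaMap X S A A φ r fun _ => hA).trans ?_
    exact ((congrArg _ hr).trans (map_zero _)).symm

/-- The sum of the components over all subsets is a left inverse: on the summand indexed by `A`,
only the component at `A` survives. The sum is finite because `S` is. -/
theorem convToDeltaMap_injective (X : CatLie) (S : FinBij) :
    Function.Injective (convToDeltaMap X S) := by
  classical
  have : Finite S.carrier := S.finite
  have : Fintype (Set S.carrier) := Fintype.ofFinite _
  have key : (∑ B : Set S.carrier, deltaToConvComponent X S B) ∘ₗ convToDeltaMap X S =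
      LinearMap.id := by
    refine conv_ext fun A φ r => ?_
    rw [LinearMap.comp_apply, LinearMap.sum_apply, Finset.sum_eq_single A]
    · exact deltaToConvComponent_convToDeltaMap_self X S A φ r
    · exact fun B _ hB => deltaToConvComponent_convToDeltaMap X S A B φ r fun h => absurd h hB
    · exact fun h => absurd (Finset.mem_univ A) h
  exact Function.LeftInverse.injective (LinearMap.congr_fun key)

/-! ### Components of the direct sum over surjections, and the image -/

theorem component_summandι_self {S T : Type} (f : {f : S → T // Function.Surjective f})
    (x : Summand f.1) : component f (summandι f x) = x := by
  classical
  exact DirectSum.component.lof_self ..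

theorem component_summandι_of_ne {S T : Type} {f g : {f : S → T // Function.Surjective f}}
    (h : f ≠ g) (x : Summand f.1) : component g (summandι f x) = 0 := by
  classical
  exact (DirectSum.component.of ..).trans (dif_neg h)

theorem sum_summandι_component {S T : Type} [Fintype {f : S → T // Function.Surjective f}]
    (φ : LieHoms S T) : ∑ f, summandι f (component f φ) = φ := by
  have key : ∑ f, summandι f ∘ₗ component f = (LinearMap.id : LieHoms S T →ₗ[ℚ] LieHoms S T) := by
    refine lieHoms_ext fun f hf a ha => ?_
    rw [LinearMap.sum_apply, Finset.sum_eq_single ⟨f, hf⟩]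
    · exact congrArg (summandι ⟨f, hf⟩) (component_summandι_self ⟨f, hf⟩ _)
    · intro g _ hg
      exact (congrArg (summandι g) (component_summandι_of_ne hg.symm _)).trans (map_zero _)
    · exact fun h => absurd (Finset.mem_univ _) h
  exact (LinearMap.sum_apply _ _ _).symm.trans (LinearMap.congr_fun key φ)

theorem card_fiber_last {S A : Type} {n : ℕ} (σ : S ≃ Option A) (f : A → Fin n) :
    Nat.card ↑((finSuccEquivLast.symm ∘ Option.map f ∘ σ) ⁻¹' {Fin.last n}) = 1 := by
  have : (finSuccEquivLast.symm ∘ Option.map f ∘ σ) ⁻¹' {Fin.last n} = {σ.symm none} := by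
    ext s
    simp [Equiv.symm_apply_eq, Equiv.eq_symm_apply]
  rw [this]
  simp

/-- The surjection underlying a boxed element sends only the omitted point to the last element, so
it is never the given `f`. -/
theorem component_convToDeltaMap (X : CatLie) (S : FinBij)
    (f : {f : S.carrier → Fin (X.n + 1) // Function.Surjective f})
    (hf : Nat.card ↑(f.1 ⁻¹' {Fin.last X.n}) ≠ 1) :
    component f ∘ₗ convToDeltaMap X S = 0 := by
  refine conv_ext fun A φ r => ?_
  refine (congrArg (component f) (convToDeltaMap_convι X S A φ r)).trans ?_
  rw [LinearMap.zero_apply]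
  by_cases hA : Nat.card ↑Aᶜ = 1
  · rw [convToDeltaSummand_tmul X.n S A hA φ r, map_smul]
    refine (congrArg _ ?_).trans (smul_zero _)
    change LieHoms A (Fin X.n) at φ
    induction φ using lieHoms_induction with
    | hzero => simp only [map_zero, LinearMap.zero_apply]
    | hadd χ χ' h h' => simp only [map_add, LinearMap.add_apply, h, h', add_zero]
    | hsmul r χ h => simp only [map_smul, LinearMap.smul_apply, h, smul_zero]
    | helem g hg a ha =>
    unfold perm
    rw [box_elem, comp_elem, comp_elem]
    refine component_summandι_of_ne (fun h => hf ?_) _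
    rw [← h]
    exact card_fiber_last (splitEquiv A hA) g
  · rw [convToDeltaSummand_of_ne X.n S A hA, LinearMap.zero_apply, map_zero]

theorem exists_eq_optionMap {S T : Type} (f : Option S → Option T)
    (h : ∀ o, f o = none ↔ o = none) : ∃ g, f = Option.map g := by
  have h' : ∀ s, ∃ t, f (some s) = some t := fun s =>
    Option.ne_none_iff_exists'.1 fun e => Option.some_ne_none s ((h _).1 e)
  choose g hg using h'
  refine ⟨g, funext fun o => ?_⟩
  cases o with
  | none => exact (h none).2 rfl
  | some s => exact hg s

/-- The subset to use is the complement of the last fibre; along the corresponding decomposition the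
element becomes one fixed by unboxing and boxing again. -/
theorem elem_mem_range_convToDeltaMap (X : CatLie) (S : FinBij)
    (f : S.carrier → Fin (X.n + 1)) (hf : Function.Surjective f)
    (a : Fin (X.n + 1) → FreeLieAlgebra ℚ S.carrier) (ha : ∀ t, a t ∈ lieOn (f ⁻¹' {t}))
    (hcard : Nat.card ↑(f ⁻¹' {Fin.last X.n}) = 1) :
    elem f hf a ha ∈ LinearMap.range (convToDeltaMap X S) := by
  have hA : Nat.card ↑((f ⁻¹' {Fin.last X.n})ᶜ)ᶜ = 1 := by rwa [compl_compl]
  set A : Set S.carrier := (f ⁻¹' {Fin.last X.n})ᶜ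
  let ψ : LieHoms (Option A) (Option (Fin X.n)) :=
    comp (perm finSuccEquivLast) (comp (elem f hf a ha) (perm (splitEquiv A hA).symm))
  have hψ : box (unbox ψ) = ψ := by
    -- By the choice of `A`, the omitted point is the only one over the last element, so the
    -- transported surjection preserves and reflects `none`.
    obtain ⟨g, hg⟩ := exists_eq_optionMap (finSuccEquivLast ∘ f ∘ (splitEquiv A hA).symm) (by
      intro o
      rw [Function.comp_apply, Function.comp_apply, ← Equiv.eq_symm_apply,
        finSuccEquivLast_symm_none, ← Equiv.apply_symm_apply (splitEquiv A hA) o,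
        Equiv.symm_apply_apply, splitEquiv_eq_none_iff]
      exact (Set.notMem_compl_iff (s := f ⁻¹' {Fin.last X.n})).symm)
    unfold ψ perm
    rw [comp_elem, comp_elem]
    exact box_unbox_elem hg _ _ _
  refine ⟨convι (catLieFunctor.obj X) unitI S A
    ((unbox ψ : LieHoms A (Fin X.n)) ⊗ₜ unitGen (S.sub Aᶜ) hA), ?_⟩
  rw [convToDeltaMap_convι, convToDeltaSummand_tmul X.n S A hA]
  refine (one_smul ℚ _).trans ?_
  rw [hψ]
  unfold ψ
  rw [comp_assoc, comp_assoc, comp_perm_perm, Equiv.self_trans_symm, comp_perm_refl,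
    ← comp_assoc, comp_perm_perm, Equiv.self_trans_symm, perm_refl_comp]

/-- An element is the sum of its components. Those with a larger last fibre are zero by assumption,
and each of the others is spanned by pure tensors, which have preimages. -/
theorem range_convToDeltaMap (X : CatLie) (S : FinBij) :
    LinearMap.range (convToDeltaMap X S) = deltaOneSpace S.carrier X.n := by
  classical
  refine le_antisymm ?_ fun φ hφ => ?_
  · rintro _ ⟨x, rfl⟩
    refine (Submodule.mem_iInf _).2 fun f => ?_
    exact LinearMap.congr_fun (component_convToDeltaMap X S f.1 f.2) x
  · have : Finite S.carrier := S.finite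
    have : Fintype {f : S.carrier → Fin (X.n + 1) // Function.Surjective f} := Fintype.ofFinite _
    rw [← sum_summandι_component φ]
    refine Submodule.sum_mem _ fun f _ => ?_
    by_cases hf : Nat.card ↑(f.1 ⁻¹' {Fin.last X.n}) = 1
    -- Containment in the range is phrased as vanishing of a linear map into the quotient, which can
    -- be tested on pure tensors.
    · have key : (LinearMap.range (convToDeltaMap X S)).mkQ ∘ₗ summandι f = 0 := by
        refine summand_ext fun a => ?_
        refine (Submodule.Quotient.mk_eq_zero _).2 ?_
        exact elem_mem_range_convToDeltaMap X S f.1 f.2 (fun t => a t) (fun t => (a t).2) hf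
      exact (Submodule.Quotient.mk_eq_zero _).1 (LinearMap.congr_fun key _)
    · have h0 : component f φ = 0 := (Submodule.mem_iInf _).1 hφ ⟨f, hf⟩
      rw [h0, map_zero]
      exact zero_mem _

/-! ### Epimorphisms of bimodules -/

/-- The component of a morphism of bimodules at an object of `CatLie` and a finite set. -/
def Bimod.app {E F : Bimod} (p : E ⟶ F) (X : CatLie) (S : FinBijᵒᵖ) :
    (E.obj.obj X).obj S ⟶ (F.obj.obj X).obj S :=
  (p.hom.app X).app S

theorem Bimod.epi_of_surjective {E F : Bimod} (p : E ⟶ F)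
    (h : ∀ X S, Function.Surjective (Bimod.app p X S).hom) : Epi p := by
  have : ∀ X, Epi (p.hom.app X) := fun X => by
    have : ∀ S, Epi ((p.hom.app X).app S) := fun S => (ModuleCat.epi_iff_surjective _).2 (h X S)
    exact NatTrans.epi_of_epi_app _
  have : Epi p.hom := NatTrans.epi_of_epi_app _
  exact isLinear.ι.epi_of_epi_map this

/-- The cokernel in the category of all functors is a quotient of a linear functor, hence itself a
bimodule. An epimorphism of bimodules must kill it, so it is an epimorphism of functors and thus
pointwise surjective. -/
theorem Bimod.surjective_of_epi {E F : Bimod} (p : E ⟶ F) [Epi p] (X : CatLie) (S : FinBijᵒᵖ) :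
    Function.Surjective (Bimod.app p X S).hom := by
  let Q : Bimod := ⟨cokernel p.hom, isLinear.prop_of_epi (cokernel.π p.hom) F.property⟩
  let q : F ⟶ Q := ObjectProperty.homMk (cokernel.π p.hom)
  have hq : q = 0 := by
    rw [← cancel_epi p, comp_zero]
    exact ObjectProperty.hom_ext _ (cokernel.condition p.hom)
  have hπ : cokernel.π p.hom = 0 := congrArg (fun f : F ⟶ Q => f.hom) hq
  have : Epi p.hom := Preadditive.epi_of_cokernel_zero hπ
  have : Epi (p.hom.app X) := inferInstance
  exact (ModuleCat.epi_iff_surjective _).1 (inferInstanceAs (Epi ((p.hom.app X).app S)))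

/-! ### Averaging over bijections -/

/-- The finite set with `k` elements. -/
def FinBij.fin (k : ℕ) : FinBij := ⟨Fin k, inferInstance⟩

/-- The inverse of a morphism of `Σ`. -/
def FinBij.inv {S T : FinBij} (e : S ⟶ T) : T ⟶ S := (FinBij.toEquiv e).symm

theorem FinBij.inv_comp {S T : FinBij} (e : S ⟶ T) : FinBij.inv e ≫ e = 𝟙 T :=
  Equiv.symm_trans_self (FinBij.toEquiv e)

theorem FinBij.comp_inv {S T : FinBij} (e : S ⟶ T) : e ≫ FinBij.inv e = 𝟙 S :=
  Equiv.self_trans_symm (FinBij.toEquiv e)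

theorem FinBij.inv_comp_comp {S T U : FinBij} (e : T ⟶ S) (f : S ⟶ U) :
    FinBij.inv e ≫ e ≫ f = f := by
  rw [← Category.assoc, FinBij.inv_comp, Category.id_comp]

theorem FinBij.comp_inv_comp {S T U : FinBij} (e : S ⟶ T) (f : S ⟶ U) :
    e ≫ FinBij.inv e ≫ f = f := by
  rw [← Category.assoc, FinBij.comp_inv, Category.id_comp]

theorem FinBij.inv_comp_rev {S T U : FinBij} (e : S ⟶ T) (f : T ⟶ U) :
    FinBij.inv (e ≫ f) ≫ e = FinBij.inv f :=
  (Category.assoc (FinBij.inv f) (FinBij.inv e) e).trans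
    ((congrArg _ (FinBij.inv_comp e)).trans (Category.comp_id _))

instance (S T : FinBij) : Fintype (S ⟶ T) :=
  have := S.finite
  have := T.finite
  have : Finite (S ⟶ T) := inferInstanceAs (Finite (S.carrier ≃ T.carrier))
  Fintype.ofFinite _

theorem FinBij.card_hom_fin (S : FinBij) {k : ℕ} (h : Nat.card S.carrier = k) :
    Fintype.card (S ⟶ FinBij.fin k) = k.factorial := by
  classical
  have := S.finite
  have : Fintype S.carrier := Fintype.ofFinite _
  have e : S.carrier ≃ Fin k := h ▸ Finite.equivFin S.carrier
  rw [← Nat.card_eq_fintype_card]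
  refine (Nat.card_congr (Equiv.equivCongr e (Equiv.refl (Fin k)))).trans ?_
  exact Nat.card_eq_fintype_card.trans ((Fintype.card_perm).trans (by rw [Fintype.card_fin]))

/-- The average over all bijections `S ≃ {1, …, k}` of the conjugates of a linear map. -/
def average {M N : RightMod} {k : ℕ}
    (b : M.obj (.op (FinBij.fin k)) ⟶ N.obj (.op (FinBij.fin k))) (S : FinBijᵒᵖ) :
    M.obj S ⟶ N.obj S :=
  (k.factorial : ℚ)⁻¹ • ∑ σ : S.unop ⟶ FinBij.fin k,
    M.map (FinBij.inv σ).op ≫ b ≫ N.map σ.op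

/-- Composition with `e` permutes the terms: it identifies the bijections from `S` to `{1, …, k}`
with those from `T`. -/
theorem map_comp_average {M N : RightMod} {k : ℕ}
    (b : M.obj (.op (FinBij.fin k)) ⟶ N.obj (.op (FinBij.fin k))) {S T : FinBijᵒᵖ} (e : S ⟶ T) :
    M.map e ≫ average b T = average b S ≫ N.map e := by
  unfold average
  rw [Linear.comp_smul, Linear.smul_comp, Preadditive.comp_sum, Preadditive.sum_comp]
  congr 1
  let r : (S.unop ⟶ FinBij.fin k) ≃ (T.unop ⟶ FinBij.fin k) :=
    { toFun σ := e.unop ≫ σ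
      invFun τ := FinBij.inv e.unop ≫ τ
      left_inv := FinBij.inv_comp_comp e.unop
      right_inv := FinBij.comp_inv_comp e.unop }
  refine (Fintype.sum_equiv r _ _ fun σ => ?_).symm
  have h₁ : FinBij.inv (e.unop ≫ σ) ≫ e.unop = FinBij.inv σ := FinBij.inv_comp_rev e.unop σ
  change _ = M.map e ≫ M.map (FinBij.inv (e.unop ≫ σ)).op ≫ b ≫ N.map (e.unop ≫ σ).op
  rw [op_comp, N.map_comp, ← M.map_comp_assoc, ← h₁]
  simp only [Category.assoc, op_comp, Quiver.Hom.op_unop]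

/-- Used with the left action of `CatLie` for `α` and `β`: it commutes with the right action of `Σ`,
so averaging does not destroy compatibility with it. -/
theorem app_comp_average {M N M' N' : RightMod} {k : ℕ} (α : M ⟶ M') (β : N ⟶ N')
    {b : M.obj (.op (FinBij.fin k)) ⟶ N.obj (.op (FinBij.fin k))}
    {b' : M'.obj (.op (FinBij.fin k)) ⟶ N'.obj (.op (FinBij.fin k))}
    (h : α.app _ ≫ b' = b ≫ β.app _) (S : FinBijᵒᵖ) :
    α.app S ≫ average b' S = average b S ≫ β.app S := by
  unfold average
  rw [Linear.comp_smul, Linear.smul_comp, Preadditive.comp_sum, Preadditive.sum_comp]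
  congr 1
  refine Finset.sum_congr rfl fun σ _ => ?_
  rw [← α.naturality_assoc, reassoc_of% h, Category.assoc, Category.assoc, β.naturality]

/-- Each of the `k!` terms becomes `a` after composition with `p`, as both are natural, and division
by `k!` is possible over `ℚ`. The cardinality hypothesis guarantees that there are `k!` terms;
otherwise the sum is empty. -/
theorem average_comp_app {M N F : RightMod} {k : ℕ} (p : N ⟶ F) (a : M ⟶ F)
    {b : M.obj (.op (FinBij.fin k)) ⟶ N.obj (.op (FinBij.fin k))}
    (h : b ≫ p.app _ = a.app _) (S : FinBijᵒᵖ) (hS : Nat.card S.unop.carrier = k) :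
    average b S ≫ p.app S = a.app S := by
  unfold average
  rw [Linear.smul_comp, Preadditive.sum_comp, Finset.sum_congr rfl (g := fun _ => a.app S)]
  · rw [Finset.sum_const, Finset.card_univ, FinBij.card_hom_fin S.unop hS, ← Nat.cast_smul_eq_nsmul ℚ,
      smul_smul, inv_mul_cancel₀ (by exact_mod_cast k.factorial_ne_zero), one_smul]
  · intro σ _
    rw [Category.assoc, Category.assoc, p.naturality, reassoc_of% h, a.naturality_assoc,
      ← F.map_comp, ← op_comp, FinBij.comp_inv]
    exact (congrArg (a.app S ≫ ·) (F.map_id S)).trans (Category.comp_id _)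

/-- A bimodule `B` is projective if maps out of `B` lift through surjections, compatibly with the
left action of `CatLie` but not necessarily with the right action of `Σ`, on each of the sets
`{1, …, k}`. -/
theorem Bimod.projective_of_lifts (B : Bimod)
    (H : ∀ {E F : Bimod} (p : E ⟶ F) (α : B ⟶ F),
      (∀ X S, Function.Surjective (Bimod.app p X S).hom) → ∀ k : ℕ,
      ∃ b : ∀ X, (B.obj.obj X).obj (.op (FinBij.fin k)) ⟶ (E.obj.obj X).obj (.op (FinBij.fin k)),
        (∀ {X Y : CatLie} (φ : X ⟶ Y),
          (B.obj.map φ).app _ ≫ b Y = b X ≫ (E.obj.map φ).app _) ∧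
        ∀ X, b X ≫ Bimod.app p X _ = Bimod.app α X _) : Projective B where
  factors {F E} α p _ := by
    choose b hb hbα using H p α (Bimod.surjective_of_epi p)
    refine ⟨ObjectProperty.homMk
      { app X := { app S := average (b (Nat.card S.unop.carrier) X) S, naturality S T e := ?_ },
        naturality X Y φ := ?_ }, ?_⟩
    -- The lift at a set is averaged from the one at its cardinality; sets joined by a bijection use
    -- the same one.
    · have h : Nat.card S.unop.carrier = Nat.card T.unop.carrier :=
        (Nat.card_congr (FinBij.toEquiv e.unop)).symm
      rw [h]
      exact map_comp_average _ e
    · exact NatTrans.ext (funext fun S => app_comp_average _ _ (hb _ φ) S)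
    · refine ObjectProperty.hom_ext _ (NatTrans.ext (funext fun X => NatTrans.ext
        (funext fun S => ?_)))
      exact average_comp_app (p.hom.app X) (α.hom.app X) (hbα _ X) S rfl

/-! ### Projectivity of `CatLie` and `CatLie ⊙ I` -/

/-- The left action of `CatLie` on a bimodule, as a bilinear map. -/
def Bimod.act (E : Bimod) (X Y : CatLie) (S : FinBijᵒᵖ) :
    (X ⟶ Y) →ₗ[ℚ] ((E.obj.obj X).obj S : Type) →ₗ[ℚ] ((E.obj.obj Y).obj S : Type) where
  toFun φ := ((E.obj.map φ).app S).hom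
  map_add' φ ψ := by rw [((isLinear_iff _).1 E.property).1]; rfl
  map_smul' r φ := by rw [((isLinear_iff _).1 E.property).2]; rfl

theorem Bimod.act_id (E : Bimod) (X : CatLie) (S : FinBijᵒᵖ) (x : (E.obj.obj X).obj S) :
    E.act X X S (𝟙 X) x = x := by
  change ((E.obj.map (𝟙 X)).app S).hom x = x
  rw [E.obj.map_id]
  rfl

theorem Bimod.map_act (E : Bimod) {X Y Z : CatLie} (φ : X ⟶ Y) (ψ : Y ⟶ Z) (S : FinBijᵒᵖ)
    (x : (E.obj.obj X).obj S) :
    ((E.obj.map ψ).app S).hom (E.act X Y S φ x) = E.act X Z S (φ ≫ ψ) x := by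
  change _ = ((E.obj.map (φ ≫ ψ)).app S).hom x
  rw [E.obj.map_comp]
  rfl

theorem Bimod.act_map (E : Bimod) {X Y : CatLie} (φ : X ⟶ Y) {S T : FinBijᵒᵖ} (e : S ⟶ T)
    (x : (E.obj.obj X).obj S) :
    E.act X Y T φ (((E.obj.obj X).map e).hom x) = ((E.obj.obj Y).map e).hom (E.act X Y S φ x) :=
  LinearMap.congr_fun (congrArg ModuleCat.Hom.hom ((E.obj.map φ).naturality e)) x

theorem Bimod.app_act {E F : Bimod} (p : E ⟶ F) {X Y : CatLie} (φ : X ⟶ Y) (S : FinBijᵒᵖ)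
    (x : (E.obj.obj X).obj S) :
    (Bimod.app p Y S).hom (E.act X Y S φ x) = F.act X Y S φ ((Bimod.app p X S).hom x) :=
  LinearMap.congr_fun (congrArg ModuleCat.Hom.hom
    (congrArg (fun f => NatTrans.app f S) (p.hom.naturality φ))) x

/-- On the set with `k` elements this is the Yoneda lemma: a natural map out of `CatLie(k, -)` is
given by the image of the identity, so a lift `y` of that single element suffices. -/
theorem projective_catLie : Projective catLie := by
  refine Bimod.projective_of_lifts _ fun {E F} p α hp k => ?_
  let x : (catLie.obj.obj ⟨k⟩).obj (.op (FinBij.fin k)) := perm (Equiv.refl (Fin k))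
  obtain ⟨y, hy⟩ := hp ⟨k⟩ (.op (FinBij.fin k)) ((Bimod.app α _ _).hom x)
  refine ⟨fun X => ModuleCat.ofHom ((E.act ⟨k⟩ X _).flip y), fun φ => ?_, fun X => ?_⟩
  · exact ModuleCat.hom_ext (LinearMap.ext fun ψ => (E.map_act ψ φ _ y).symm)
  · refine ModuleCat.hom_ext (LinearMap.ext fun ψ => ?_)
    refine (Bimod.app_act p (X := ⟨k⟩) ψ _ y).trans ?_
    refine (congrArg _ hy).trans ((Bimod.app_act α (X := ⟨k⟩) ψ _ x).symm.trans ?_)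
    exact congrArg _ (comp_perm_refl (S := Fin k) (T := Fin X.n) ψ)

theorem comp_comp_perm_symm {R S T : Type} (φ : LieHoms S T) (e : S ≃ R) :
    comp (comp φ (perm e.symm)) (perm e) = φ := by
  rw [comp_assoc, comp_perm_perm, Equiv.self_trans_symm, comp_perm_refl]

theorem convBimod_act_convι (X Y : CatLie) (φ : X ⟶ Y) (S : FinBij) (A : Set S.carrier)
    (ψ : LieHoms A (Fin X.n)) (r : unitSpace (S.sub Aᶜ)) :
    (convBimod catLie unitI).act X Y (.op S) φ
      (convι (catLieFunctor.obj X) unitI S A (ψ ⊗ₜ r)) =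
      convι (catLieFunctor.obj Y) unitI S A
        ((comp (φ : LieHoms (Fin X.n) (Fin Y.n)) ψ : LieHoms A (Fin Y.n)) ⊗ₜ r) :=
  convPush_convι (catLieFunctor.map φ) unitI S A ψ r

/-- On a fixed finite set the bimodule is the sum of the functors `CatLie(A, -)` over the subsets
`A` with one-point complement. Numbering `A` makes each of them representable, generated by the
numbering itself, so one lifts one generator for each `A`. -/
theorem projective_convBimod_catLie : Projective (convBimod catLie unitI) := by
  refine Bimod.projective_of_lifts _ fun {E F} p α hp k => ?_
  set S := FinBij.fin k
  have hfin : ∀ A : Set S.carrier, Finite A := fun A => (S.sub A).finite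
  let X' : Set S.carrier → CatLie := fun A => ⟨Nat.card A⟩
  let σ : ∀ A : Set S.carrier, A ≃ Fin (X' A).n := fun A => Finite.equivFin A
  -- Quantifying over all `r` treats every `A` uniformly; when `I` vanishes on the complement the
  -- only `r` is zero, and `y = 0` serves.
  have hy : ∀ A : Set S.carrier, ∃ y : (E.obj.obj (X' A)).obj (.op S),
      ∀ r : unitSpace (S.sub Aᶜ), (Bimod.app p (X' A) (.op S)).hom ((r : ℚ) • y) =
        (Bimod.app α (X' A) (.op S)).hom
          (convι (catLieFunctor.obj (X' A)) unitI S A (perm (σ A) ⊗ₜ r)) := by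
    intro A
    by_cases hA : Nat.card ↑Aᶜ = 1
    · obtain ⟨y, hy⟩ := hp (X' A) (.op S) ((Bimod.app α (X' A) (.op S)).hom
          (convι (catLieFunctor.obj (X' A)) unitI S A
            (perm (σ A) ⊗ₜ unitGen (S.sub Aᶜ) hA)))
      refine ⟨y, fun r => ?_⟩
      refine (map_smul _ _ _).trans ((congrArg _ hy).trans ((map_smul _ _ _).symm.trans ?_))
      refine congrArg _ ((map_smul _ _ _).symm.trans (congrArg _ ?_))
      exact (TensorProduct.tmul_smul _ _ _).symm.trans
        (congrArg _ (eq_smul_unitGen (S.sub Aᶜ) hA r).symm)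
    · refine ⟨0, fun r => ?_⟩
      rw [eq_zero_of_mem_unitSpace hA r, smul_zero, map_zero]
      refine (Eq.trans (congrArg _ ?_) (map_zero _)).symm
      exact (congrArg _ (TensorProduct.tmul_zero _ _)).trans (map_zero _)
  choose y hy using hy
  -- The lift sends `ψ ⊗ r` to `r` times the action of `ψ ∘ σ⁻¹` on the chosen `y A`.
  let b (X : CatLie) (A : Set S.carrier) :
      LieHoms A (Fin X.n) ⊗[ℚ] unitSpace (S.sub Aᶜ) →ₗ[ℚ] ((E.obj.obj X).obj (.op S) : Type) :=
    TensorProduct.lift ((LinearMap.lsmul ℚ _ ∘ₗ (unitSpace (S.sub Aᶜ)).subtype).flip ∘ₗ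
      (E.act (X' A) X (.op S)).flip (y A) ∘ₗ comp.flip (perm (σ A).symm))
  have hb (X : CatLie) (A : Set S.carrier) (ψ : LieHoms A (Fin X.n)) (r : unitSpace (S.sub Aᶜ)) :
      convDesc (M := catLieFunctor.obj X) (N := unitI) (b X)
        (convι (catLieFunctor.obj X) unitI S A (ψ ⊗ₜ r)) =
          (r : ℚ) • E.act (X' A) X (.op S) (comp ψ (perm (σ A).symm)) (y A) :=
    convDesc_convι (M := catLieFunctor.obj X) (N := unitI) (b X) A (ψ ⊗ₜ r)
  refine ⟨fun X => ModuleCat.ofHom (convDesc (M := catLieFunctor.obj X) (N := unitI) (b X)),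
    fun {X Y} φ => ?_, fun X => ?_⟩
  · refine ModuleCat.hom_ext (conv_ext fun A ψ r => ?_)
    refine (congrArg _ (convBimod_act_convι X Y φ S A ψ r)).trans ((hb Y A _ r).trans ?_)
    refine Eq.trans ?_ (congrArg _ (hb X A ψ r)).symm
    refine Eq.trans ?_ (map_smul ((E.obj.map φ).app (.op S)).hom _ _).symm
    refine congrArg _ (Eq.trans ?_ (E.map_act (X := X' A) _ φ _ (y A)).symm)
    exact congrArg (fun ψ => E.act (X' A) Y (.op S) ψ (y A)) (comp_assoc (T := A) φ ψ _)
  · refine ModuleCat.hom_ext (conv_ext fun A ψ r => ?_)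
    refine (congrArg _ (hb X A ψ r)).trans ?_
    rw [← map_smul]
    refine (Bimod.app_act p (X := X' A) _ _ _).trans ((congrArg _ (hy A r)).trans ?_)
    refine (Bimod.app_act α (X := X' A) _ _ _).symm.trans (congrArg _ ?_)
    refine (convBimod_act_convι (X' A) X _ S A _ r).trans ?_
    exact congrArg (fun ψ : LieHoms A (Fin X.n) =>
      convι (catLieFunctor.obj X) unitI S A (ψ ⊗ₜ r)) (comp_comp_perm_symm ψ (σ A))

/-! ### Free bimodules -/

/-- The underlying space `⨁ₘ CatLie(m, n) ⊗ Mₘ(S)` of the free bimodule on a family of right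
`ℚΣ`-modules. -/
abbrev FreeSpace (M : CatLie → RightMod) (X : CatLie) (S : FinBijᵒᵖ) : Type :=
  ⨁ m : CatLie, (m ⟶ X) ⊗[ℚ] ((M m).obj S : Type)

open Classical in
/-- The inclusion of the summand of the free bimodule indexed by `m`. -/
def freeι (M : CatLie → RightMod) (X : CatLie) (S : FinBijᵒᵖ) (m : CatLie) :
    (m ⟶ X) ⊗[ℚ] ((M m).obj S : Type) →ₗ[ℚ] FreeSpace M X S :=
  DirectSum.lof ℚ _ (fun m : CatLie => (m ⟶ X) ⊗[ℚ] ((M m).obj S : Type)) m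

open Classical in
/-- The linear map out of the free bimodule with given restriction to each summand. -/
def freeDesc {M : CatLie → RightMod} {X : CatLie} {S : FinBijᵒᵖ} {V : Type} [AddCommGroup V]
    [Module ℚ V] (F : ∀ m : CatLie, (m ⟶ X) →ₗ[ℚ] ((M m).obj S : Type) →ₗ[ℚ] V) :
    FreeSpace M X S →ₗ[ℚ] V :=
  DirectSum.toModule ℚ _ V fun m => TensorProduct.lift (F m)

theorem freeDesc_freeι {M : CatLie → RightMod} {X : CatLie} {S : FinBijᵒᵖ} {V : Type}
    [AddCommGroup V] [Module ℚ V] (F : ∀ m : CatLie, (m ⟶ X) →ₗ[ℚ] ((M m).obj S : Type) →ₗ[ℚ] V)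
    (m : CatLie) (φ : m ⟶ X) (x : (M m).obj S) :
    freeDesc F (freeι M X S m (φ ⊗ₜ x)) = F m φ x := by
  classical
  exact (DirectSum.toModule_lof ..).trans (TensorProduct.lift.tmul _ _)

theorem free_ext {M : CatLie → RightMod} {X : CatLie} {S : FinBijᵒᵖ} {V : Type} [AddCommGroup V]
    [Module ℚ V] {F G : FreeSpace M X S →ₗ[ℚ] V}
    (h : ∀ m φ x, F (freeι M X S m (φ ⊗ₜ x)) = G (freeι M X S m (φ ⊗ₜ x))) : F = G := by
  classical
  exact DirectSum.linearMap_ext _ fun m => TensorProduct.ext' fun φ x => h m φ x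

/-- The universal bilinear map into a summand of the free bimodule. -/
def freeMk (M : CatLie → RightMod) (X : CatLie) (S : FinBijᵒᵖ) (m : CatLie) :
    (m ⟶ X) →ₗ[ℚ] ((M m).obj S : Type) →ₗ[ℚ] FreeSpace M X S :=
  (TensorProduct.mk ℚ _ _).compr₂ (freeι M X S m)

/-- The right `Σ`-action on the free bimodule. -/
def freePull (M : CatLie → RightMod) (X : CatLie) {S T : FinBijᵒᵖ} (e : S ⟶ T) :
    FreeSpace M X S →ₗ[ℚ] FreeSpace M X T :=
  freeDesc fun m => (freeMk M X T m).compl₂ ((M m).map e).hom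

/-- The left action of `CatLie` on the free bimodule. -/
def freePush (M : CatLie → RightMod) {X Y : CatLie} (ψ : X ⟶ Y) (S : FinBijᵒᵖ) :
    FreeSpace M X S →ₗ[ℚ] FreeSpace M Y S :=
  freeDesc fun m => freeMk M Y S m ∘ₗ Linear.rightComp ℚ m ψ

theorem freePull_freeι (M : CatLie → RightMod) (X : CatLie) {S T : FinBijᵒᵖ} (e : S ⟶ T)
    (m : CatLie) (φ : m ⟶ X) (x : (M m).obj S) :
    freePull M X e (freeι M X S m (φ ⊗ₜ x)) = freeι M X T m (φ ⊗ₜ ((M m).map e).hom x) :=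
  freeDesc_freeι ..

theorem freePush_freeι (M : CatLie → RightMod) {X Y : CatLie} (ψ : X ⟶ Y) (S : FinBijᵒᵖ)
    (m : CatLie) (φ : m ⟶ X) (x : (M m).obj S) :
    freePush M ψ S (freeι M X S m (φ ⊗ₜ x)) = freeι M Y S m ((φ ≫ ψ) ⊗ₜ x) :=
  freeDesc_freeι ..

/-- The right `ℚΣ`-module of values at `X` of the free bimodule. -/
def freeObj (M : CatLie → RightMod) (X : CatLie) : RightMod where
  obj S := ModuleCat.of ℚ (FreeSpace M X S)
  map e := ModuleCat.ofHom (freePull M X e)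
  map_id S := ModuleCat.hom_ext (free_ext fun m φ x => by
    refine (freePull_freeι M X (𝟙 S) m φ x).trans ?_
    rw [(M m).map_id]
    rfl)
  map_comp {S T U} e e' := ModuleCat.hom_ext (free_ext fun m φ x => by
    refine (freePull_freeι M X (e ≫ e') m φ x).trans ?_
    refine Eq.trans ?_ (congrArg (freePull M X e') (freePull_freeι M X e m φ x)).symm
    rw [freePull_freeι, (M m).map_comp]
    rfl)

/-- The functor underlying the free bimodule on a family of right `ℚΣ`-modules. -/
def freeFunctor (M : CatLie → RightMod) : CatLie ⥤ RightMod where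
  obj X := freeObj M X
  map {X Y} ψ :=
    { app S := ModuleCat.ofHom (freePush M ψ S)
      naturality S T e := ModuleCat.hom_ext (free_ext fun m φ x => by
        refine (congrArg (freePush M ψ T) (freePull_freeι M X e m φ x)).trans ?_
        refine Eq.trans ?_ (congrArg (freePull M Y e) (freePush_freeι M ψ S m φ x)).symm
        rw [freePull_freeι, freePush_freeι]) }
  map_id X := NatTrans.ext (funext fun S => ModuleCat.hom_ext (free_ext fun m φ x => by
    refine (freePush_freeι M (𝟙 X) S m φ x).trans ?_
    rw [Category.comp_id]
    rfl))
  map_comp {X Y Z} ψ χ := NatTrans.ext (funext fun S => ModuleCat.hom_ext (free_ext fun m φ x => by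
    refine (freePush_freeι M (ψ ≫ χ) S m φ x).trans ?_
    refine Eq.trans ?_ (congrArg (freePush M χ S) (freePush_freeι M ψ S m φ x)).symm
    rw [freePush_freeι, Category.assoc]))

theorem isLinear_freeFunctor (M : CatLie → RightMod) : isLinear (freeFunctor M) := by
  refine (isLinear_iff _).2 ⟨fun {X Y} ψ χ => ?_, fun {X Y} r ψ => ?_⟩
  · refine NatTrans.ext (funext fun S => ModuleCat.hom_ext (free_ext fun m φ x => ?_))
    refine (freePush_freeι M (ψ + χ) S m φ x).trans ?_
    refine Eq.trans ?_
      (congrArg₂ (· + ·) (freePush_freeι M ψ S m φ x) (freePush_freeι M χ S m φ x)).symm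
    rw [Preadditive.comp_add, TensorProduct.add_tmul, map_add]
  · refine NatTrans.ext (funext fun S => ModuleCat.hom_ext (free_ext fun m φ x => ?_))
    refine (freePush_freeι M (r • ψ) S m φ x).trans ?_
    refine Eq.trans ?_ (congrArg (r • ·) (freePush_freeι M ψ S m φ x)).symm
    rw [Linear.comp_smul]
    exact (congrArg _ (TensorProduct.smul_tmul' _ _ _).symm).trans (map_smul _ _ _)

/-- The free bimodule on a family of right `ℚΣ`-modules. -/
def freeBimod (M : CatLie → RightMod) : Bimod := ⟨freeFunctor M, isLinear_freeFunctor M⟩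

/-- No assumption on `M` is needed, because lifts need not be equivariant: on a fixed set, the
generators form vector spaces, along which linear maps lift through any surjection. -/
theorem projective_freeBimod (M : CatLie → RightMod) : Projective (freeBimod M) := by
  refine Bimod.projective_of_lifts _ fun {E F} p α hp k => ?_
  -- The generators are the elements `𝟙 m ⊗ x`; `s` lifts their images linearly, and the left action
  -- extends it.
  have hs (m : CatLie) : ∃ s : ((M m).obj (.op (FinBij.fin k)) : Type) →ₗ[ℚ]
      ((E.obj.obj m).obj (.op (FinBij.fin k)) : Type),
      (Bimod.app p m (.op (FinBij.fin k))).hom ∘ₗ s =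
        (Bimod.app α m (.op (FinBij.fin k))).hom ∘ₗ freeMk M m (.op (FinBij.fin k)) m (𝟙 m) :=
    Module.projective_lifting_property _ _ (hp m (.op (FinBij.fin k)))
  choose s hs using hs
  let b (X : CatLie) : FreeSpace M X (.op (FinBij.fin k)) →ₗ[ℚ]
      ((E.obj.obj X).obj (.op (FinBij.fin k)) : Type) :=
    freeDesc fun m => (E.act m X (.op (FinBij.fin k))).compl₂ (s m)
  have hb (X m : CatLie) (φ : m ⟶ X) (x : (M m).obj (.op (FinBij.fin k))) :
      b X (freeι M X (.op (FinBij.fin k)) m (φ ⊗ₜ x)) = E.act m X _ φ (s m x) :=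
    freeDesc_freeι ..
  refine ⟨fun X => ModuleCat.ofHom (b X), fun {X Y} ψ => ?_, fun X => ?_⟩
  · refine ModuleCat.hom_ext (free_ext fun m φ x => ?_)
    refine (congrArg (b Y) (freePush_freeι M ψ _ m φ x)).trans ((hb Y m _ x).trans ?_)
    exact ((congrArg _ (hb X m φ x)).trans (E.map_act φ ψ _ _)).symm
  · refine ModuleCat.hom_ext (free_ext fun m φ x => ?_)
    refine (congrArg _ (hb X m φ x)).trans ((Bimod.app_act p φ _ _).trans ?_)
    refine (congrArg _ (LinearMap.congr_fun (hs m) x)).trans ?_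
    refine (Bimod.app_act α φ _ _).symm.trans (congrArg _ ?_)
    refine (freePush_freeι M φ _ m (𝟙 m) x).trans ?_
    rw [Category.id_comp]

/-- The canonical map onto a bimodule from the free bimodule on its values. -/
def freeCounit (F : Bimod) : freeBimod F.obj.obj ⟶ F :=
  ObjectProperty.homMk
    { app X :=
        { app S := ModuleCat.ofHom (freeDesc fun m => F.act m X S)
          naturality S T e := ModuleCat.hom_ext (free_ext fun m φ x => by
            refine (congrArg (freeDesc fun m => F.act m X T)
              (freePull_freeι F.obj.obj X e m φ x)).trans ((freeDesc_freeι ..).trans ?_)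
            refine (F.act_map φ e x).trans (congrArg ((F.obj.obj X).map e).hom ?_)
            exact (freeDesc_freeι (M := F.obj.obj) (fun m => F.act m X S) m φ x).symm) }
      naturality X Y ψ := NatTrans.ext (funext fun S => ModuleCat.hom_ext
        (free_ext fun m φ x => by
          refine (congrArg (freeDesc fun m => F.act m Y S)
            (freePush_freeι F.obj.obj ψ S m φ x)).trans ((freeDesc_freeι ..).trans ?_)
          refine (F.map_act φ ψ S x).symm.trans (congrArg ((F.obj.map ψ).app S).hom ?_)
          exact (freeDesc_freeι (M := F.obj.obj) (fun m => F.act m X S) m φ x).symm)) }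

theorem epi_freeCounit (F : Bimod) : Epi (freeCounit F) :=
  Bimod.epi_of_surjective _ fun X S x => ⟨freeι F.obj.obj X S X (𝟙 X ⊗ₜ x),
    (freeDesc_freeι (M := F.obj.obj) (fun m => F.act m X S) X (𝟙 X) x).trans (F.act_id X S x)⟩

/-- This is what allows the presentation of `H₀` to be continued to a full resolution. -/
instance : EnoughProjectives Bimod where
  presentation F :=
    ⟨{ p := freeBimod F.obj.obj
       projective := projective_freeBimod _
       f := freeCounit F
       epi := epi_freeCounit F }⟩

end CatLieSyzygy

end

theorem mainTheorem4 :
    -- the map `CatLie ⊙ I → δ CatLie` is an isomorphism onto `δ⁽¹⁾CatLie`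
    (∀ (X : CatLieSyzygy.CatLie) (S : CatLieSyzygy.FinBij),
      Function.Injective (CatLieSyzygy.convToDeltaMap X S) ∧
      LinearMap.range (CatLieSyzygy.convToDeltaMap X S) =
        CatLieSyzygy.deltaOneSpace S.carrier X.n) ∧
    -- the complex begins a projective resolution of `H₀`
    CategoryTheory.Projective CatLieSyzygy.catLie ∧
    CategoryTheory.Projective (CatLieSyzygy.convBimod CatLieSyzygy.catLie CatLieSyzygy.unitI) ∧
    CatLieSyzygy.BeginsProjectiveResolution CatLieSyzygy.differential CatLieSyzygy.hZeroπ ∧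
    -- `0 → H₁ → CatLie ⊙ I → CatLie → H₀ → 0` exhibits `H₁` as the second syzygy of `H₀`
    CatLieSyzygy.ExhibitsSecondSyzygy
      CatLieSyzygy.hOneι CatLieSyzygy.differential CatLieSyzygy.hZeroπ :=
  have h₀ := CatLieSyzygy.projective_catLie
  have h₁ := CatLieSyzygy.projective_convBimod_catLie
  have := CatLieSyzygy.epi_hZeroπ
  ⟨fun X S => ⟨CatLieSyzygy.convToDeltaMap_injective X S, CatLieSyzygy.range_convToDeltaMap X S⟩,
    h₀, h₁, CatLieSyzygy.beginsProjectiveResolution_of_exact _ _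
      CatLieSyzygy.differential_comp_hZeroπ CatLieSyzygy.exact_differential_hZeroπ,
    CatLieSyzygy.exhibitsSecondSyzygy_hOneι h₀ h₁⟩
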